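/- Let $n,m,N$ be positive integers and let $T^n=(\mathbb R/\mathbb Z)^n$. For $f\in L^2(T^n;\mathbb C)$ and $a\in\mathbb Z^n$ put $c_a(f):=\int_{T^n} f(x)\,e^{-2\pi \mathbf i\langle a,x\rangle}\,dx$, and let $w_a:=(1+\langle a,a\rangle)^m$. Let $H^m(T^n)$ be the space of all $f\in L^2(T^n;\mathbb C)$ whose weak derivatives up to order $m$ lie in $L^2$, with the norm $\|f\|^2=\sum_{a\in\mathbb Z^n} w_a|c_a(f)|^2$, let $B:=\{f\in H^m(T^n):\|f\|\le 1\}\subset L^2(T^n)$, and let $E:=\{(c_a(f))_{a\in\mathbb Z^n}: f\in B\}\subset \ell_2(\mathbb Z^n)$. For a finite family $\mathbf a$ of elements of $\mathbb Z^n$ (repetitions allowed, empty family allowed) write $c^{\mathbf a}:=\prod_{a\in\mathbf a}c_a$. Given $A=(\mathbf a_1,\dots,\mathbf a_N)$, the Sobolev moment cone $C(A)\subset\mathbb C^N$ is the set of all vectors $\big(\int_B \prod_{a\in\mathbf a_k} c_a(f)\,d\mu(f)\big)_{k=1}^N$, where $\mu$ ranges over the non-negative Radon (locally finite and tight) Borel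 measures on $L^2(T^n)$ supported on $B$. For $a\in\mathbb Z^n$ let $\delta_a:=\max_i|a_i|$. For integers $r,\rho\ge 0$ let $\Sigma_{r,\rho}$ be the set of finite sums $\sum_k q_k^*q_k=\sum_k|q_k|^2$, where the $q_k$ are complex polynomials of total degree at most $r$ in the variables $c_a$ with $\delta_a\le\rho$, and let $\Sigma_{-1,\rho}:=\{0\}$. Let $$Q_{r,\rho}:=\Big\{s_0+s_1\Big(1-\sum_{\delta_a\le\rho} w_a|c_a|^2\Big): s_0\in\Sigma_{r,\rho},\ s_1\in\Sigma_{r-1,\rho}\Big\},\qquad Q_{\infty,\infty}:=\bigcup_{r,\rho\ge 0}Q_{r,\rho}.$$ Let $\gamma$ be a locally finite Borel measure on $\ell_2(\mathbb Z^n)$ (the reference measure) such that every non-empty relatively open subset of $E$ has positive $\gamma$-measure; for instance, the law of a family of independent centred complex Gaussian variables $c_a$, whose real and imaginary parts are independent with variance $\lambda_a>0$, where $\sum_a w_a\lambda_a<\infty$. Let $$C^{\mathrm{inn}}_{\infty,\infty}(A):=\Big\{\Big(\int_E c^{\mathbf a_k}\,p(c)\,d\gamma(c)\Big)_{k=1}^N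 : p\in Q_{\infty,\infty}\Big\}\subset\mathbb C^N .$$ Then $$\overline{C^{\mathrm{inn}}_{\infty,\infty}(A)}=C(A).$$ The same equality holds if in the definition of $\Sigma_{r,\rho}$ (and hence of $Q_{r,\rho}$ and $C^{\mathrm{inn}}_{\infty,\infty}(A)$) the $q_k$ are allowed to be polynomials of total degree at most $r$ in the variables $c_a$ and $\overline{c_a}$ with $\delta_a\le\rho$. -/

import Mathlib

open MeasureTheory
open scoped ContDiff ENNReal

noncomputable section

namespace SobolevMoment

/-! ### The torus, Fourier coefficients and the Sobolev space -/

/-- Lebesgue (= Haar probability) measure on the torus `Tⁿ = (ℝ/ℤ)ⁿ`. -/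
abbrev torusMeasure (n : ℕ) : Measure (UnitAddTorus (Fin n)) :=
  Measure.pi fun _ => AddCircle.haarAddCircle

/-- The complex Hilbert space `L²(Tⁿ; ℂ)`. -/
abbrev TorusL2 (n : ℕ) : Type := Lp ℂ 2 (torusMeasure n)

/-- The complex Hilbert space `ℓ²(ℤⁿ; ℂ)`. -/
abbrev SeqL2 (n : ℕ) : Type := lp (fun _ : Fin n → ℤ => ℂ) 2

instance torusL2MeasurableSpace (n : ℕ) : MeasurableSpace (TorusL2 n) := borel _

instance torusL2BorelSpace (n : ℕ) : BorelSpace (TorusL2 n) := ⟨rfl⟩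

instance seqL2MeasurableSpace (n : ℕ) : MeasurableSpace (SeqL2 n) := borel _

instance seqL2BorelSpace (n : ℕ) : BorelSpace (SeqL2 n) := ⟨rfl⟩

/-- The Fourier coefficient `c_a = ∫ f(x) e_a(x) dx`, where `e_a(x) = exp (-2πi ⟨a, x⟩)`. -/
def fourierCoefficient {n : ℕ} (f : TorusL2 n) (a : Fin n → ℤ) : ℂ :=
  ∫ x, f x * UnitAddTorus.mFourier (-a) x ∂(torusMeasure n)

/-- A function on the torus is smooth if its periodic lift to `ℝⁿ` is `C^∞`. -/
def IsSmooth {n : ℕ} (φ : UnitAddTorus (Fin n) → ℂ) : Prop :=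
  ContDiff ℝ ∞ fun x : Fin n → ℝ => φ fun i => (x i : UnitAddCircle)

/-- The (classical) partial derivative `∂φ/∂x_i` on the torus. -/
def partialDeriv {n : ℕ} (i : Fin n) (φ : UnitAddTorus (Fin n) → ℂ)
    (x : UnitAddTorus (Fin n)) : ℂ :=
  deriv (fun t : ℝ => φ (x + Pi.single i (t : UnitAddCircle))) 0

/-- `g` is the weak partial derivative of `f` in the `i`-th direction. -/
def IsWeakPartial {n : ℕ} (i : Fin n) (f g : TorusL2 n) : Prop :=
  ∀ φ : UnitAddTorus (Fin n) → ℂ, IsSmooth φ →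
    ∫ x, f x * partialDeriv i φ x ∂(torusMeasure n) = -∫ x, g x * φ x ∂(torusMeasure n)

/-- Membership in `H^m(Tⁿ)`: all weak derivatives of order at most `m` exist and lie in `L²`. -/
def MemSobolev {n : ℕ} : ℕ → TorusL2 n → Prop
  | 0, _ => True
  | m + 1, f => ∀ i : Fin n, ∃ g : TorusL2 n, IsWeakPartial i f g ∧ MemSobolev m g

/-- The weight `w_a = (1 + ⟨a, a⟩)^m`. -/
def weight {n : ℕ} (m : ℕ) (a : Fin n → ℤ) : ℝ := (1 + ∑ i, (a i : ℝ) ^ 2) ^ m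

/-- The closed unit ball `B` of `H^m(Tⁿ)` for the norm `‖f‖² = ∑_a w_a |c_a|²`. -/
def sobolevBall (n m : ℕ) : Set (TorusL2 n) :=
  {f | MemSobolev m f ∧ Summable (fun a => weight m a * ‖fourierCoefficient f a‖ ^ 2) ∧
    ∑' a, weight m a * ‖fourierCoefficient f a‖ ^ 2 ≤ 1}

/-- The set `E = F B` of all Fourier coefficient sequences of elements of `B`. -/
def fourierEllipsoid (n m : ℕ) : Set (SeqL2 n) :=
  {c | ∃ f ∈ sobolevBall n m, ∀ a, c a = fourierCoefficient f a}

/-! ### The moment cone -/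

/-- The monomial `m_𝐚(f) = ∏_{a ∈ 𝐚} c_a`, where `c_a` are the Fourier coefficients of `f` and `𝐚`
is a finite family of multi-indices with repetitions. -/
def functionMonomial {n : ℕ} (s : Multiset (Fin n → ℤ)) (f : TorusL2 n) : ℂ :=
  (s.map fun a => fourierCoefficient f a).prod

/-- The monomial `c^𝐚 = ∏_{a ∈ 𝐚} c_a`. -/
def seqMonomial {n : ℕ} (s : Multiset (Fin n → ℤ)) (c : SeqL2 n) : ℂ :=
  (s.map fun a => c a).prod

/-- The Sobolev moment cone `C(A)`: the vectors of moments of all non-negative Radon measures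
(locally finite and tight) on `L²(Tⁿ)` supported on `B`. -/
def momentCone {n N : ℕ} (m : ℕ) (A : Fin N → Multiset (Fin n → ℤ)) : Set (Fin N → ℂ) :=
  {y | ∃ μ : Measure (TorusL2 n), IsLocallyFiniteMeasure μ ∧ μ.InnerRegular ∧
    μ (sobolevBall n m)ᶜ = 0 ∧
    ∀ k, y k = ∫ f in sobolevBall n m, functionMonomial (A k) f ∂μ}

/-! ### Truncated polynomials, sums of squares and quadratic modules -/

/-- The harmonic degree `δ_a = max_i |a_i|`. -/
def harmonicDegree {n : ℕ} (a : Fin n → ℤ) : ℕ := Finset.univ.sup fun i => (a i).natAbs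

/-- The finite set of all `a ∈ ℤⁿ` with `δ_a ≤ ρ`. -/
def harmonicBox (n ρ : ℕ) : Finset (Fin n → ℤ) :=
  Fintype.piFinset fun _ => Finset.Icc (-(ρ : ℤ)) ρ

theorem mem_harmonicBox {n ρ : ℕ} (a : Fin n → ℤ) :
    a ∈ harmonicBox n ρ ↔ harmonicDegree a ≤ ρ := by
  simp only [harmonicBox, harmonicDegree, Fintype.mem_piFinset, Finset.mem_Icc,
    Finset.sup_le_iff, Finset.mem_univ, true_imp_iff]
  exact forall_congr' fun i => by omega

/-- Functions on `ℓ²(ℤⁿ)` given by complex polynomials in the variables `c_a`, of algebraic degree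
at most `r` and harmonic degree at most `ρ`. -/
def analyticPolys (n r ρ : ℕ) : Set (SeqL2 n → ℂ) :=
  {g | ∃ q : MvPolynomial (Fin n → ℤ) ℂ, q.totalDegree ≤ r ∧
    (∀ a ∈ q.vars, harmonicDegree a ≤ ρ) ∧ ∀ c, g c = MvPolynomial.eval (fun a => c a) q}

/-- Functions on `ℓ²(ℤⁿ)` given by complex polynomials in the variables `c_a` (left copy) and their
complex conjugates (right copy), of algebraic degree at most `r` and harmonic degree at most `ρ`. -/
def conjPolys (n r ρ : ℕ) : Set (SeqL2 n → ℂ) :=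
  {g | ∃ q : MvPolynomial ((Fin n → ℤ) ⊕ (Fin n → ℤ)) ℂ, q.totalDegree ≤ r ∧
    (∀ v ∈ q.vars, harmonicDegree (Sum.elim id id v) ≤ ρ) ∧
    ∀ c, g c = MvPolynomial.eval (Sum.elim (fun a => c a) (fun a => starRingEnd ℂ (c a))) q}

/-- The finite sums `∑_k q_k^* q_k` with `q_k ∈ V`, as functions. -/
def sumsOfSquares {n : ℕ} (V : Set (SeqL2 n → ℂ)) : Set (SeqL2 n → ℝ) :=
  {s | ∃ (l : ℕ) (q : Fin l → SeqL2 n → ℂ), (∀ k, q k ∈ V) ∧ ∀ c, s c = ∑ k, ‖q k c‖ ^ 2}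

/-- `Σ_{r-1}`; there are no polynomials of degree at most `-1` but zero. -/
def sumsOfSquaresPred {n : ℕ} (V : ℕ → Set (SeqL2 n → ℂ)) : ℕ → Set (SeqL2 n → ℝ)
  | 0 => {0}
  | r + 1 => sumsOfSquares (V r)

/-- The truncated quadratic module `Q_{r,ρ}` built from the polynomial spaces `V r ρ`. -/
def quadraticModule {n : ℕ} (m : ℕ) (V : ℕ → ℕ → Set (SeqL2 n → ℂ)) (r ρ : ℕ) :
    Set (SeqL2 n → ℝ) :=
  {p | ∃ s₀ ∈ sumsOfSquares (V r ρ), ∃ s₁ ∈ sumsOfSquaresPred (fun d => V d ρ) r,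
    ∀ c, p c = s₀ c + s₁ c * (1 - ∑ a ∈ harmonicBox n ρ, weight m a * ‖c a‖ ^ 2)}

/-- The full quadratic module `Q_{∞,∞} = ⋃_{r,ρ} Q_{r,ρ}`. -/
def fullQuadraticModule {n : ℕ} (m : ℕ) (V : ℕ → ℕ → Set (SeqL2 n → ℂ)) :
    Set (SeqL2 n → ℝ) :=
  ⋃ (r : ℕ) (ρ : ℕ), quadraticModule m V r ρ

/-- The vectors of moments of the measures with density `p ∈ Q` with respect to `γ` on `E`. -/
def innerCone {n N : ℕ} (m : ℕ) (γ : Measure (SeqL2 n)) (Q : Set (SeqL2 n → ℝ))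
    (A : Fin N → Multiset (Fin n → ℤ)) : Set (Fin N → ℂ) :=
  {y | ∃ p ∈ Q, ∀ k, y k = ∫ c in fourierEllipsoid n m, seqMonomial (A k) c * (p c : ℂ) ∂γ}

end SobolevMoment

end

noncomputable section

namespace SobolevMoment

/-! ### Convex hulls and cones in finite dimension -/

section Cones

open scoped NNReal

variable {E : Type*} [NormedAddCommGroup E] [NormedSpace ℝ E]

/-! Both sides equal `pointCone`, the convex cone generated by the monomial vectors at the points of
the ellipsoid `E`. Since `m > 0`, the weights tend to infinity and `E` is compact. The cone is
closed for one of two reasons: if some family in `A` is empty, the generators form a compact set on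
an affine hyperplane missing the origin; otherwise averaging over rotations `c ↦ ζ c` shows that the
cone is a linear subspace (`isClosed_pointCone`).

Integrals over a compact set with values in a closed convex cone stay in it, so moment vectors lie
in `pointCone`, and Dirac measures give the converse (`momentCone_eq_pointCone`). Elements of the
quadratic module are nonnegative on `E`, so the inner cone lies in `pointCone` as well.

The remaining point is density. By Hahn–Banach it suffices that a functional `F` with positive real
part at some monomial vector has positive real part at the moment vector of some density `|q|²`
(`exists_densityMoment_pos`). The monomials are holomorphic, so the maximum principle moves the
point of positivity to a finitely supported `v` with `∑ w_a |v_a|² = 1` (`exists_boundary_point`).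
At such a `v` the affine function `(1 + ⟨v, c⟩_w) / 2` peaks, and high powers of its squared modulus
concentrate `γ` where `c` agrees with `v` on the box containing all indices of `A`; there the
monomials take their values at `v`. Squares of analytic polynomials thus suffice, so both versions
of the theorem follow together. -/

theorem isCompact_convexHull_of_isCompact [FiniteDimensional ℝ E] {s : Set E} (hs : IsCompact s) :
    IsCompact (convexHull ℝ s) := by
  rcases s.eq_empty_or_nonempty with rfl | ⟨p₀, hp₀⟩
  · simp
  -- Carathéodory: `d` points always suffice, so the hull is the image of simplex times `s ^ d`.
  -- Shorter combinations are padded with weight `0` at `p₀`.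
  let d := Module.finrank ℝ E + 1
  let Φ : (Fin d → ℝ) × (Fin d → E) → E := fun x => ∑ i, x.1 i • x.2 i
  have hΦ : Continuous Φ := by fun_prop
  have hc : IsCompact (stdSimplex ℝ (Fin d) ×ˢ Set.pi Set.univ fun _ : Fin d => s) :=
    (isCompact_stdSimplex ℝ (Fin d)).prod (isCompact_univ_pi fun _ => hs)
  convert! hc.image hΦ
  refine Set.Subset.antisymm (fun x hx => ?_) ?_
  · obtain ⟨ι, _, z, w, hz, hind, hw, hw1, rfl⟩ := eq_pos_convex_span_of_mem_convexHull hx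
    have hcard : Fintype.card ι ≤ Fintype.card (Fin d) := by
      rw [Fintype.card_fin]
      exact hind.card_le_finrank_succ.trans (Nat.succ_le_succ (Submodule.finrank_le _))
    obtain ⟨e⟩ := Function.Embedding.nonempty_of_card_le hcard
    refine ⟨(Function.extend e w 0, Function.extend e z fun _ => p₀), ⟨⟨fun j => ?_, ?_⟩, ?_⟩, ?_⟩
    · by_cases hj : ∃ i, e i = j
      · obtain ⟨i, rfl⟩ := hj
        simpa [e.injective.extend_apply] using (hw i).le
      · simp [Function.extend_apply' _ _ _ hj]
    · rw [← hw1]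
      exact (Fintype.sum_of_injective e e.injective _ _
        (fun j hj => by simp [Function.extend_apply' _ _ _ hj])
        fun i => by simp [e.injective.extend_apply]).symm
    · intro j _
      by_cases hj : ∃ i, e i = j
      · obtain ⟨i, rfl⟩ := hj
        simpa [e.injective.extend_apply] using hz ⟨i, rfl⟩
      · simpa [Function.extend_apply' _ _ _ hj] using hp₀
    · exact (Fintype.sum_of_injective e e.injective _ _
        (fun j hj => by simp [Function.extend_apply' _ _ _ hj])
        fun i => by simp [e.injective.extend_apply]).symm
  · rintro _ ⟨⟨w, z⟩, ⟨hw, hz⟩, rfl⟩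
    exact (convex_convexHull ℝ s).sum_mem (fun i _ => hw.1 i) hw.2
      fun i _ => subset_convexHull ℝ s (hz i trivial)

theorem convexHull_subset_span_nnreal (K : Set E) :
    convexHull ℝ K ⊆ (Submodule.span ℝ≥0 K : Set E) := by
  refine convexHull_min Submodule.subset_span fun x hx y hy a b ha hb _ => ?_
  exact add_mem (Submodule.smul_mem _ (⟨a, ha⟩ : ℝ≥0) hx) (Submodule.smul_mem _ (⟨b, hb⟩ : ℝ≥0) hy)

theorem exists_smul_convexHull_of_mem_span {K : Set E} (hK : K.Nonempty) {y : E}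
    (hy : y ∈ Submodule.span ℝ≥0 K) : ∃ t : ℝ, 0 ≤ t ∧ ∃ z ∈ convexHull ℝ K, y = t • z := by
  induction hy using Submodule.span_induction with
  | mem x hx => exact ⟨1, zero_le_one, x, subset_convexHull ℝ K hx, (one_smul _ _).symm⟩
  | zero =>
    obtain ⟨x, hx⟩ := hK
    exact ⟨0, le_rfl, x, subset_convexHull ℝ K hx, (zero_smul _ _).symm⟩
  | add x y _ _ hx hy =>
    obtain ⟨s, hs, u, hu, rfl⟩ := hx
    obtain ⟨t, ht, v, hv, rfl⟩ := hy
    rcases (add_nonneg hs ht).eq_or_lt with h0 | h0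
    · refine ⟨0, le_rfl, u, hu, ?_⟩
      rw [show s = 0 by linarith, show t = 0 by linarith]
      simp
    · refine ⟨s + t, h0.le, (s / (s + t)) • u + (t / (s + t)) • v,
        convex_convexHull ℝ K hu hv (by positivity) (by positivity) (by field_simp), ?_⟩
      rw [smul_add, smul_smul, smul_smul, mul_div_cancel₀ _ h0.ne', mul_div_cancel₀ _ h0.ne']
  | smul a x _ hx =>
    obtain ⟨s, hs, u, hu, rfl⟩ := hx
    exact ⟨a * s, by positivity, u, hu, by rw [NNReal.smul_def, smul_smul]⟩

/-- On `t • z` with `z` in the hull of `K`, `φ` reads off the scale `t`. Near `y` the scale is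
therefore below `φ y + 1`, and the cone is locally contained in a compact set of its own points. -/
theorem isClosed_span_nnreal_of_functional [FiniteDimensional ℝ E] {K : Set E} (hK : IsCompact K) (φ : E →L[ℝ] ℝ)
    (hφ : ∀ z ∈ K, φ z = 1) : IsClosed (Submodule.span ℝ≥0 K : Set E) := by
  rcases K.eq_empty_or_nonempty with rfl | hne
  · simp
  have hφ' : ∀ z ∈ convexHull ℝ K, φ z = 1 := by
    intro z hz
    have hc : Convex ℝ {z | φ z = 1} := convex_hyperplane φ.toLinearMap.isLinear 1
    exact convexHull_min hφ hc hz
  refine isClosed_of_closure_subset fun y hy => ?_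
  have hcpt : IsCompact ((fun p : ℝ × E => p.1 • p.2) ''
      (Set.Icc 0 (φ y + 1) ×ˢ convexHull ℝ K)) :=
    (isCompact_Icc.prod (isCompact_convexHull_of_isCompact hK)).image (by fun_prop)
  have hU : IsOpen {x | φ x < φ y + 1} := isOpen_lt φ.continuous continuous_const
  have hy' : y ∈ closure ((Submodule.span ℝ≥0 K : Set E) ∩ {x | φ x < φ y + 1}) := by
    rw [Set.inter_comm]
    exact hU.inter_closure ⟨by simp, hy⟩
  have hsub : (Submodule.span ℝ≥0 K : Set E) ∩ {x | φ x < φ y + 1} ⊆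
      (fun p : ℝ × E => p.1 • p.2) '' (Set.Icc 0 (φ y + 1) ×ˢ convexHull ℝ K) := by
    rintro x ⟨hx, hxU⟩
    obtain ⟨t, ht, z, hz, rfl⟩ := exists_smul_convexHull_of_mem_span hne hx
    refine ⟨(t, z), ⟨⟨ht, ?_⟩, hz⟩, rfl⟩
    have : φ (t • z) < φ y + 1 := hxU
    rw [map_smul, hφ' z hz, smul_eq_mul, mul_one] at this
    exact this.le
  obtain ⟨⟨t, z⟩, ⟨ht, hz⟩, rfl⟩ := closure_minimal hsub hcpt.isClosed hy'
  exact Submodule.smul_mem _ (⟨t, ht.1⟩ : ℝ≥0) (convexHull_subset_span_nnreal K hz)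

/-- A cone stable under negation is a real subspace, hence closed in finite dimension. -/
theorem isClosed_span_nnreal_of_neg_mem [FiniteDimensional ℝ E] {K : Set E}
    (hK : ∀ z ∈ K, -z ∈ Submodule.span ℝ≥0 K) : IsClosed (Submodule.span ℝ≥0 K : Set E) := by
  have hneg : ∀ z ∈ Submodule.span ℝ≥0 K, -z ∈ Submodule.span ℝ≥0 K := by
    intro z hz
    induction hz using Submodule.span_induction with
    | mem x hx => exact hK x hx
    | zero => simp
    | add x y _ _ hx hy => rw [neg_add]; exact add_mem hx hy
    | smul a x _ hx => rw [← smul_neg]; exact Submodule.smul_mem _ a hx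
  let S : Submodule ℝ E :=
    { carrier := Submodule.span ℝ≥0 K
      add_mem' := fun ha hb => add_mem ha hb
      zero_mem' := zero_mem _
      smul_mem' := by
        intro c x hx
        rcases le_total 0 c with hc | hc
        · exact Submodule.smul_mem _ (⟨c, hc⟩ : ℝ≥0) hx
        · rw [← neg_neg c, neg_smul]
          exact hneg _ (Submodule.smul_mem _ (⟨-c, neg_nonneg.2 hc⟩ : ℝ≥0) hx) }
  exact S.closed_of_finiteDimensional

end Cones

/-! ### Fourier coefficients of weak derivatives -/

section WeakDerivatives

open UnitAddTorus Complex

variable {n : ℕ}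

/-- The Fourier transform as an isometric isomorphism `L²(Tⁿ) ≃ ℓ²(ℤⁿ)`. -/
def fourierEquiv (n : ℕ) : TorusL2 n ≃ₗᵢ[ℂ] SeqL2 n :=
  (mFourierBasis (d := Fin n)).repr

theorem fourierEquiv_apply (f : TorusL2 n) (a : Fin n → ℤ) :
    fourierEquiv n f a = fourierCoefficient f a := by
  refine (mFourierBasis_repr (d := Fin n) f a).trans ?_
  simp only [fourierCoefficient, mFourierCoeff, smul_eq_mul, mul_comm]
  rfl

/-- The covering map `ℝⁿ → Tⁿ`. -/
def torusMk (n : ℕ) (x : Fin n → ℝ) : UnitAddTorus (Fin n) := fun i => (x i : UnitAddCircle)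

theorem isOpenQuotientMap_torusMk (n : ℕ) : IsOpenQuotientMap (torusMk n) :=
  IsOpenQuotientMap.piMap fun _ : Fin n => QuotientAddGroup.isOpenQuotientMap_mk

theorem torusMk_add_single (x : Fin n → ℝ) (i : Fin n) (t : ℝ) :
    torusMk n x + Pi.single i (t : UnitAddCircle) = torusMk n (x + t • Pi.single i (1 : ℝ)) := by
  funext j
  rcases eq_or_ne j i with rfl | h
  · simp [torusMk]
  · simp [torusMk, h]

theorem IsSmooth.continuous {φ : UnitAddTorus (Fin n) → ℂ} (hφ : IsSmooth φ) : Continuous φ :=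
  (isOpenQuotientMap_torusMk n).continuous_comp_iff.1 (ContDiff.continuous hφ)

theorem IsSmooth.hasDerivAt {φ : UnitAddTorus (Fin n) → ℂ} (hφ : IsSmooth φ) (x : Fin n → ℝ)
    (i : Fin n) :
    HasDerivAt (fun t : ℝ => φ (torusMk n x + Pi.single i (t : UnitAddCircle)))
      (fderiv ℝ (fun x => φ (torusMk n x)) x (Pi.single i 1)) 0 := by
  simp only [torusMk_add_single]
  have h1 : HasFDerivAt (fun x => φ (torusMk n x)) (fderiv ℝ (fun x => φ (torusMk n x)) x)
      (x + (0 : ℝ) • Pi.single i (1 : ℝ)) := by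
    rw [zero_smul, add_zero]
    exact (ContDiff.differentiable hφ (by simp) x).hasFDerivAt
  have h2 : HasDerivAt (fun t : ℝ => x + t • Pi.single i (1 : ℝ)) (Pi.single i 1) 0 := by
    simpa using ((hasDerivAt_id (0 : ℝ)).smul_const (Pi.single i (1 : ℝ))).const_add x
  exact h1.comp_hasDerivAt (0 : ℝ) h2

theorem IsSmooth.continuous_partialDeriv {φ : UnitAddTorus (Fin n) → ℂ} (hφ : IsSmooth φ)
    (i : Fin n) : Continuous (partialDeriv i φ) := by
  refine (isOpenQuotientMap_torusMk n).continuous_comp_iff.1 ?_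
  have : partialDeriv i φ ∘ torusMk n =
      fun x => fderiv ℝ (fun x => φ (torusMk n x)) x (Pi.single i 1) :=
    funext fun x => (hφ.hasDerivAt x i).deriv
  rw [this]
  exact (ContDiff.continuous_fderiv hφ (by simp)).clm_apply continuous_const

theorem IsSmooth.hasDerivAt_partialDeriv {φ : UnitAddTorus (Fin n) → ℂ} (hφ : IsSmooth φ)
    (x : UnitAddTorus (Fin n)) (i : Fin n) (t : ℝ) :
    HasDerivAt (fun s : ℝ => φ (x + Pi.single i (s : UnitAddCircle)))
      (partialDeriv i φ (x + Pi.single i (t : UnitAddCircle))) t := by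
  obtain ⟨y, hy⟩ := (isOpenQuotientMap_torusMk n).surjective
    (x + Pi.single i (t : UnitAddCircle))
  have h0 := hφ.hasDerivAt y i
  have h1 := h0.deriv ▸ h0
  rw [hy] at h1
  have h3 : HasDerivAt
      (fun s : ℝ => φ (x + Pi.single i (t : UnitAddCircle) + Pi.single i (s : UnitAddCircle)))
      (partialDeriv i φ (x + Pi.single i (t : UnitAddCircle))) (t - t) := by
    rw [sub_self]
    exact h1
  have h4 := h3.comp_sub_const t t
  convert! h4 using 1
  funext s
  simp only [add_assoc, ← Pi.single_add]
  congr 3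
  rw [← AddCircle.coe_add, add_sub_cancel]

theorem mFourier_add_single (a : Fin n → ℤ) (x : UnitAddTorus (Fin n)) (i : Fin n) (t : ℝ) :
    mFourier a (x + Pi.single i (t : UnitAddCircle)) =
      mFourier a x * exp (2 * Real.pi * I * a i * t) := by
  have h : mFourier a (x + Pi.single i (t : UnitAddCircle)) =
      ∏ j, (fourier (a j) (x j) : ℂ) *
        (if j = i then exp (2 * Real.pi * I * a i * t) else 1) := by
    simp only [mFourier, ContinuousMap.coe_mk]
    refine Finset.prod_congr rfl fun j _ => ?_
    rcases eq_or_ne j i with rfl | h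
    · simp only [Pi.add_apply, Pi.single_eq_same, if_true]
      have h1 : exp (2 * Real.pi * I * a j * t) = fourier (a j) (t : UnitAddCircle) := by
        rw [fourier_coe_apply]
        simp
      rw [h1, fourier_apply, fourier_apply, fourier_apply, smul_add, AddCircle.toCircle_add,
        Circle.coe_mul]
    · simp [h]
  rw [h, Finset.prod_mul_distrib]
  simp [mFourier]

theorem hasDerivAt_integral_of_bounded_deriv {X : Type*} [TopologicalSpace X] [CompactSpace X]
    [MeasurableSpace X] [OpensMeasurableSpace X] (μ : Measure X) [IsFiniteMeasure μ]
    {F F' : ℝ → X → ℂ} {M : ℝ} (hF : ∀ t, Continuous (F t)) (hF' : ∀ t, Continuous (F' t))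
    (hM : ∀ t x, ‖F' t x‖ ≤ M) (hd : ∀ t x, HasDerivAt (fun s => F s x) (F' t x) t) (t : ℝ) :
    HasDerivAt (fun s => ∫ x, F s x ∂μ) (∫ x, F' t x ∂μ) t :=
  (hasDerivAt_integral_of_dominated_loc_of_deriv_le (x₀ := t) (bound := fun _ => M)
    (s := Set.univ) Filter.univ_mem
    (Filter.Eventually.of_forall fun s => (hF s).aestronglyMeasurable)
    ((hF t).integrable_of_hasCompactSupport (HasCompactSupport.of_compactSpace _))
    (hF' t).aestronglyMeasurable (Filter.Eventually.of_forall fun x s _ => hM s x)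
    (integrable_const M) (Filter.Eventually.of_forall fun x s _ => hd s x)).2

/-- Integration by parts through translation invariance: the integral of `mFourier a` against the
translate of `φ` by `t` in direction `i` is differentiated at `t = 0`, once under the integral sign
and once after moving the translation onto the character, where it becomes an exponential factor. -/
theorem integral_mFourier_mul_partialDeriv {φ : UnitAddTorus (Fin n) → ℂ} (hφ : IsSmooth φ)
    (a : Fin n → ℤ) (i : Fin n) :
    ∫ x, mFourier a x * partialDeriv i φ x ∂(torusMeasure n) =
      -(2 * Real.pi * I * a i) * ∫ x, mFourier a x * φ x ∂(torusMeasure n) := by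
  obtain ⟨M, hM⟩ := (isCompact_range (hφ.continuous_partialDeriv i)).isBounded.exists_norm_le
  have hcont (ψ : UnitAddTorus (Fin n) → ℂ) (hψ : Continuous ψ) (t : ℝ) :
      Continuous fun x => mFourier a x * ψ (x + Pi.single i (t : UnitAddCircle)) := by
    fun_prop
  have h1 : HasDerivAt
      (fun t : ℝ => ∫ x, mFourier a x * φ (x + Pi.single i (t : UnitAddCircle)) ∂(torusMeasure n))
      (∫ x, mFourier a x * partialDeriv i φ (x + Pi.single i ((0 : ℝ) : UnitAddCircle))
        ∂(torusMeasure n)) 0 := by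
    have hbound (x : UnitAddTorus (Fin n)) (t : ℝ) :
        ‖mFourier a x * partialDeriv i φ (x + Pi.single i (t : UnitAddCircle))‖ ≤ M := by
      rw [norm_mul]
      have h2 : ‖mFourier a x‖ ≤ 1 := 
        ((mFourier a).norm_coe_le_norm x).trans_eq mFourier_norm
      exact (mul_le_of_le_one_left (norm_nonneg _) h2).trans (hM _ (Set.mem_range_self _))
    have hderiv (x : UnitAddTorus (Fin n)) (t : ℝ) :
        HasDerivAt (fun s : ℝ => mFourier a x * φ (x + Pi.single i (s : UnitAddCircle)))
          (mFourier a x * partialDeriv i φ (x + Pi.single i (t : UnitAddCircle))) t :=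
      (hφ.hasDerivAt_partialDeriv x i t).const_mul _
    exact hasDerivAt_integral_of_bounded_deriv (torusMeasure n) (hcont φ hφ.continuous)
      (hcont _ (hφ.continuous_partialDeriv i)) (fun t x => hbound x t) (fun t x => hderiv x t) 0
  have h2 : (fun t : ℝ => ∫ x, mFourier a x * φ (x + Pi.single i (t : UnitAddCircle))
        ∂(torusMeasure n)) =
      fun t : ℝ => exp (-(2 * Real.pi * I * a i) * t) *
        ∫ x, mFourier a x * φ x ∂(torusMeasure n) := by
    funext t
    rw [← integral_add_right_eq_self (μ := torusMeasure n) (fun x => mFourier a x * φ x)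
      (Pi.single i (t : UnitAddCircle)), ← integral_const_mul]
    refine integral_congr_ae (Filter.Eventually.of_forall fun x => ?_)
    simp only [mFourier_add_single]
    have : exp (-(2 * Real.pi * I * a i) * t) * exp (2 * Real.pi * I * a i * t) = 1 := by
      rw [← exp_add]
      simp
    linear_combination -(mFourier a x * φ (x + Pi.single i (t : UnitAddCircle))) * this
  have h3 : HasDerivAt (fun t : ℝ => exp (-(2 * Real.pi * I * a i) * t) *
      ∫ x, mFourier a x * φ x ∂(torusMeasure n))
      (-(2 * Real.pi * I * a i) * ∫ x, mFourier a x * φ x ∂(torusMeasure n)) 0 := by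
    have h4 : HasDerivAt (fun t : ℝ => -(2 * Real.pi * I * a i) * (t : ℂ))
        (-(2 * Real.pi * I * a i)) 0 := by
      simpa using ((hasDerivAt_id (0 : ℝ)).ofReal_comp).const_mul (-(2 * Real.pi * I * a i))
    simpa using (h4.cexp).mul_const (∫ x, mFourier a x * φ x ∂(torusMeasure n))
  rw [h2] at h1
  simpa using h1.unique h3

/-- Parseval: the Fourier expansion of `f` is paired with the conjugate of `ψ`, the inner product
being conjugate-linear in its first argument. -/
theorem hasSum_integral_mul (f : TorusL2 n) {ψ : UnitAddTorus (Fin n) → ℂ} (hψ : Continuous ψ) :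
    HasSum (fun a => fourierCoefficient f a * ∫ x, mFourier a x * ψ x ∂(torusMeasure n))
      (∫ x, f x * ψ x ∂(torusMeasure n)) := by
  let v : TorusL2 n := ContinuousMap.toLp 2 (torusMeasure n) ℂ ⟨fun x => star (ψ x), hψ.star⟩
  have hv : v =ᵐ[torusMeasure n] fun x => star (ψ x) := ContinuousMap.coeFn_toLp _ _
  have hinner (g : TorusL2 n) : inner ℂ v g = ∫ x, g x * ψ x ∂(torusMeasure n) := by
    rw [L2.inner_def]
    refine integral_congr_ae ?_
    filter_upwards [hv] with x hx
    rw [hx]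
    simp
  have h1 := ((mFourierBasis (d := Fin n)).hasSum_repr f).mapL (innerSL ℂ v)
  simp only [innerSL_apply_apply] at h1
  rw [hinner f] at h1
  convert! h1 using 2 with a
  refine Eq.trans ?_ (inner_smul_right _ _ _).symm
  congr 1
  · exact (fourierEquiv_apply f a).symm
  · refine Eq.trans ?_ (hinner (mFourierBasis (d := Fin n) a)).symm
    refine integral_congr_ae ?_
    rw [coe_mFourierBasis]
    filter_upwards [coeFn_mFourierLp (d := Fin n) 2 a] with x hx
    rw [hx]

theorem isWeakPartial_of_fourierCoefficient {i : Fin n} {f g : TorusL2 n}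
    (h : ∀ a, fourierCoefficient g a = 2 * Real.pi * I * a i * fourierCoefficient f a) :
    IsWeakPartial i f g := by
  intro φ hφ
  refine (hasSum_integral_mul f (hφ.continuous_partialDeriv i)).unique ?_
  convert! (hasSum_integral_mul g hφ.continuous).neg using 2 with a
  rw [integral_mFourier_mul_partialDeriv hφ, h]
  ring

theorem one_le_weight (m : ℕ) (a : Fin n → ℤ) : 1 ≤ weight m a :=
  one_le_pow₀ (le_add_of_nonneg_right (Finset.sum_nonneg fun _ _ => sq_nonneg _))

/-- The derivative has coefficients `2πi a_i c_a`, and `a_i²` costs one factor `1 + ⟨a, a⟩` of the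
weight. The converse is not needed, because `sobolevBall` demands summability anyway. -/
theorem memSobolev_of_summable (m : ℕ) (f : TorusL2 n)
    (hf : Summable fun a => weight m a * ‖fourierCoefficient f a‖ ^ 2) : MemSobolev m f := by
  induction m generalizing f with
  | zero => trivial
  | succ m ih =>
    intro i
    let d : (Fin n → ℤ) → ℂ := fun a => 2 * Real.pi * I * a i * fourierCoefficient f a
    have hd : ∀ a, weight m a * ‖d a‖ ^ 2 ≤
        (2 * Real.pi) ^ 2 * (weight (m + 1) a * ‖fourierCoefficient f a‖ ^ 2) := by
      intro a
      have h1 : (a i : ℝ) ^ 2 ≤ 1 + ∑ j, (a j : ℝ) ^ 2 :=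
        (Finset.single_le_sum (f := fun j => (a j : ℝ) ^ 2) (fun _ _ => sq_nonneg _)
          (Finset.mem_univ i)).trans (le_add_of_nonneg_left zero_le_one)
      have h2 : ‖d a‖ ^ 2 = (2 * Real.pi) ^ 2 * ((a i : ℝ) ^ 2 * ‖fourierCoefficient f a‖ ^ 2) := by
        simp [d, mul_pow, mul_assoc]
      have h3 : weight (m + 1) a = weight m a * (1 + ∑ j, (a j : ℝ) ^ 2) := pow_succ _ _
      have h4 : 0 ≤ weight m a := zero_le_one.trans (one_le_weight m a)
      rw [h2, h3]
      have h5 := mul_le_mul_of_nonneg_left h1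
        (show 0 ≤ (2 * Real.pi) ^ 2 * weight m a * ‖fourierCoefficient f a‖ ^ 2 by positivity)
      linarith
    have hs : Summable fun a => weight m a * ‖d a‖ ^ 2 :=
      Summable.of_nonneg_of_le (fun a => mul_nonneg (zero_le_one.trans (one_le_weight m a))
        (sq_nonneg _)) hd (hf.mul_left _)
    have hmem : Memℓp d 2 := by
      refine memℓp_gen ?_
      simp only [ENNReal.toReal_ofNat, Real.rpow_two]
      exact Summable.of_nonneg_of_le (fun a => sq_nonneg _)
        (fun a => le_mul_of_one_le_left (sq_nonneg _) (one_le_weight m a)) hs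
    have hg : ∀ a, fourierCoefficient ((fourierEquiv n).symm ⟨d, hmem⟩) a = d a := by
      intro a
      rw [← fourierEquiv_apply, LinearIsometryEquiv.apply_symm_apply]
    exact ⟨(fourierEquiv n).symm ⟨d, hmem⟩, isWeakPartial_of_fourierCoefficient hg,
      ih _ (by simpa only [hg] using hs)⟩

/-- The ellipsoid `∑ w_a |c_a|² ≤ 1`, in terms of partial sums. -/
theorem mem_fourierEllipsoid_iff {m : ℕ} {c : SeqL2 n} :
    c ∈ fourierEllipsoid n m ↔
      ∀ s : Finset (Fin n → ℤ), ∑ a ∈ s, weight m a * ‖c a‖ ^ 2 ≤ 1 := by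
  have hnn : ∀ a, 0 ≤ weight m a * ‖c a‖ ^ 2 := fun a =>
    mul_nonneg (zero_le_one.trans (one_le_weight m a)) (sq_nonneg _)
  constructor
  · rintro ⟨f, ⟨-, hs, h1⟩, hc⟩ s
    simp only [hc] at hnn ⊢
    exact (hs.sum_le_tsum s fun a _ => hnn a).trans h1
  · intro h
    have hc : ∀ a, c a = fourierCoefficient ((fourierEquiv n).symm c) a := by
      intro a
      rw [← fourierEquiv_apply, LinearIsometryEquiv.apply_symm_apply]
    have hs := summable_of_sum_le hnn h
    refine ⟨(fourierEquiv n).symm c, ⟨memSobolev_of_summable m _ ?_, ?_, ?_⟩, hc⟩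
    · simpa only [hc] using hs
    · simpa only [hc] using hs
    · simpa only [hc] using Real.tsum_le_of_sum_le hnn h

theorem mem_sobolevBall_iff {m : ℕ} {f : TorusL2 n} :
    f ∈ sobolevBall n m ↔ fourierEquiv n f ∈ fourierEllipsoid n m := by
  constructor
  · exact fun hf => ⟨f, hf, fourierEquiv_apply f⟩
  · rintro ⟨g, hg, h⟩
    have : fourierEquiv n f = fourierEquiv n g := by
      ext a
      rw [h, fourierEquiv_apply]
    exact (fourierEquiv n).injective this ▸ hg

end WeakDerivatives

/-! ### Compactness of the ellipsoid -/

section Ellipsoid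

variable {n m : ℕ}

theorem continuous_coord (a : Fin n → ℤ) : Continuous fun c : SeqL2 n => c a :=
  (continuous_apply a).comp lp.uniformContinuous_coe.continuous

theorem weight_pos (m : ℕ) (a : Fin n → ℤ) : 0 < weight m a :=
  zero_lt_one.trans_le (one_le_weight m a)

theorem le_weight_of_notMem_harmonicBox (hm : 0 < m) {ρ : ℕ} {a : Fin n → ℤ}
    (ha : a ∉ harmonicBox n ρ) : (ρ : ℝ) ≤ weight m a := by
  rw [mem_harmonicBox, harmonicDegree, Finset.sup_le_iff] at ha
  push Not at ha
  obtain ⟨i, -, hi⟩ := ha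
  have h1 : (ρ : ℝ) ≤ ((a i).natAbs : ℝ) := by exact_mod_cast hi.le
  have h2 : ((a i).natAbs : ℝ) ≤ (a i : ℝ) ^ 2 := by
    have : (a i).natAbs ≤ (a i).natAbs ^ 2 := Nat.le_self_pow two_ne_zero _
    calc ((a i).natAbs : ℝ) ≤ ((a i).natAbs : ℝ) ^ 2 := by exact_mod_cast this
      _ = (a i : ℝ) ^ 2 := by rw [Nat.cast_natAbs, Int.cast_abs, sq_abs]
  have h3 : (a i : ℝ) ^ 2 ≤ ∑ j, (a j : ℝ) ^ 2 :=
    Finset.single_le_sum (f := fun j => (a j : ℝ) ^ 2) (fun _ _ => sq_nonneg _)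
      (Finset.mem_univ i)
  have h4 : 1 + ∑ j, (a j : ℝ) ^ 2 ≤ weight m a :=
    le_self_pow₀ (le_add_of_nonneg_right (Finset.sum_nonneg fun _ _ => sq_nonneg _)) hm.ne'
  linarith

/-- The finitely supported sequence with values `v a`, `a ∈ S`. -/
def finiteSeq (S : Finset (Fin n → ℤ)) (v : (Fin n → ℤ) → ℂ) : SeqL2 n :=
  ∑ a ∈ S, lp.single 2 a (v a)

theorem finiteSeq_apply (S : Finset (Fin n → ℤ)) (v : (Fin n → ℤ) → ℂ) (a : Fin n → ℤ) :
    finiteSeq S v a = if a ∈ S then v a else 0 := by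
  rw [finiteSeq, lp.coeFn_sum]
  refine (Finset.sum_apply _ _ _).trans ?_
  simp [Pi.single_apply]

theorem continuous_finiteSeq (S : Finset (Fin n → ℤ)) : Continuous (finiteSeq S) := by
  refine continuous_finsetSum S fun a _ => ?_
  exact ((lp.isometry_single (E := fun _ : Fin n → ℤ => ℂ) (p := 2) a).continuous).comp
    (continuous_apply a)

theorem norm_apply_le_one {c : SeqL2 n} (hc : c ∈ fourierEllipsoid n m) (a : Fin n → ℤ) :
    ‖c a‖ ≤ 1 := by
  have h1 := mem_fourierEllipsoid_iff.1 hc {a}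
  rw [Finset.sum_singleton] at h1
  have h2 := le_mul_of_one_le_left (sq_nonneg ‖c a‖) (one_le_weight m a)
  exact (sq_le_one_iff₀ (norm_nonneg _)).1 (h2.trans h1)

/-- Outside the box the weights are at least `ρ`, so the squared tail is at most `1 / ρ`, uniformly
on the ellipsoid. -/
theorem norm_sub_finiteSeq_le {c : SeqL2 n} (hm : 0 < m) (hc : c ∈ fourierEllipsoid n m)
    {ρ : ℕ} {ε : ℝ} (hε : 0 ≤ ε) (hρ : 1 ≤ ε ^ 2 * ρ) :
    ‖c - finiteSeq (harmonicBox n ρ) c‖ ≤ ε := by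
  refine lp.norm_le_of_forall_sum_le (by norm_num) hε fun s => ?_
  simp only [ENNReal.toReal_ofNat, Real.rpow_two]
  calc ∑ a ∈ s, ‖(c - finiteSeq (harmonicBox n ρ) c) a‖ ^ 2
      ≤ ∑ a ∈ s, ε ^ 2 * (weight m a * ‖c a‖ ^ 2) := by
        refine Finset.sum_le_sum fun a _ => ?_
        rw [lp.coeFn_sub, Pi.sub_apply, finiteSeq_apply]
        split_ifs with ha
        · have := weight_pos m a
          rw [sub_self, norm_zero, zero_pow two_ne_zero]
          exact mul_nonneg (sq_nonneg _) (mul_nonneg this.le (sq_nonneg _))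
        · rw [sub_zero, ← mul_assoc]
          refine le_mul_of_one_le_left (sq_nonneg _) (hρ.trans ?_)
          exact mul_le_mul_of_nonneg_left (le_weight_of_notMem_harmonicBox hm ha) (sq_nonneg _)
    _ = ε ^ 2 * ∑ a ∈ s, weight m a * ‖c a‖ ^ 2 := (Finset.mul_sum _ _ _).symm
    _ ≤ ε ^ 2 := mul_le_of_le_one_right (sq_nonneg _) (mem_fourierEllipsoid_iff.1 hc s)

theorem isClosed_fourierEllipsoid (n m : ℕ) : IsClosed (fourierEllipsoid n m) := by
  have : fourierEllipsoid n m =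
      ⋂ s : Finset (Fin n → ℤ), {c : SeqL2 n | ∑ a ∈ s, weight m a * ‖c a‖ ^ 2 ≤ 1} := by
    ext c
    simp only [mem_fourierEllipsoid_iff, Set.mem_iInter, Set.mem_ofPred_eq]
  rw [this]
  refine isClosed_iInter fun s => isClosed_le ?_ continuous_const
  exact continuous_finsetSum s fun a _ => ((continuous_coord a).norm.pow 2).const_mul _

theorem isCompact_fourierEllipsoid (n : ℕ) (hm : 0 < m) : IsCompact (fourierEllipsoid n m) := by
  refine isCompact_iff_totallyBounded_isComplete.2
    ⟨Metric.totallyBounded_iff.2 fun ε hε => ?_, (isClosed_fourierEllipsoid n m).isComplete⟩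
  -- Truncation to the box moves points by at most `ε / 4` and lands in a compact set, for which an
  -- `ε / 2`-net suffices.
  obtain ⟨ρ, hρ⟩ := exists_nat_ge (((ε / 4) ^ 2)⁻¹)
  have hρ' : 1 ≤ (ε / 4) ^ 2 * ρ := by
    have h0 : 0 < (ε / 4) ^ 2 := by positivity
    rwa [inv_le_iff_one_le_mul₀' h0] at hρ
  have hK : IsCompact (finiteSeq (harmonicBox n ρ) ''
      Set.pi Set.univ fun _ : Fin n → ℤ => Metric.closedBall (0 : ℂ) 1) :=
    (isCompact_univ_pi fun _ => isCompact_closedBall _ _).image (continuous_finiteSeq _)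
  obtain ⟨t, ht, hcover⟩ := Metric.totallyBounded_iff.1 hK.totallyBounded (ε / 2) (by positivity)
  refine ⟨t, ht, fun c hc => ?_⟩
  have h1 : finiteSeq (harmonicBox n ρ) c ∈ finiteSeq (harmonicBox n ρ) ''
      Set.pi Set.univ fun _ : Fin n → ℤ => Metric.closedBall (0 : ℂ) 1 :=
    ⟨c, fun a _ => by simpa using norm_apply_le_one hc a, rfl⟩
  obtain ⟨y, hy, hcy⟩ := Set.mem_iUnion₂.1 (hcover h1)
  refine Set.mem_iUnion₂.2 ⟨y, hy, ?_⟩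
  have h2 := norm_sub_finiteSeq_le hm hc (by positivity) hρ'
  rw [← dist_eq_norm] at h2
  rw [Metric.mem_ball] at hcy ⊢
  linarith [dist_triangle c (finiteSeq (harmonicBox n ρ) c) y]

theorem finiteSeq_mem_fourierEllipsoid {S : Finset (Fin n → ℤ)} {v : (Fin n → ℤ) → ℂ}
    (hv : ∑ a ∈ S, weight m a * ‖v a‖ ^ 2 ≤ 1) : finiteSeq S v ∈ fourierEllipsoid n m := by
  refine mem_fourierEllipsoid_iff.2 fun s => le_trans ?_ hv
  calc ∑ a ∈ s, weight m a * ‖finiteSeq S v a‖ ^ 2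
      = ∑ a ∈ s, if a ∈ S then weight m a * ‖v a‖ ^ 2 else 0 := by
        refine Finset.sum_congr rfl fun a _ => ?_
        rw [finiteSeq_apply]
        split_ifs <;> simp
    _ = ∑ a ∈ s ∩ S, weight m a * ‖v a‖ ^ 2 := by rw [Finset.sum_ite_mem]
    _ ≤ ∑ a ∈ S, weight m a * ‖v a‖ ^ 2 :=
        Finset.sum_le_sum_of_subset_of_nonneg Finset.inter_subset_right
          fun a _ _ => mul_nonneg (weight_pos m a).le (sq_nonneg _)

theorem smul_mem_fourierEllipsoid {c : SeqL2 n} (hc : c ∈ fourierEllipsoid n m) {z : ℂ}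
    (hz : ‖z‖ ≤ 1) : z • c ∈ fourierEllipsoid n m := by
  refine mem_fourierEllipsoid_iff.2 fun s => le_trans (Finset.sum_le_sum fun a _ => ?_)
    (mem_fourierEllipsoid_iff.1 hc s)
  refine mul_le_mul_of_nonneg_left ?_ (weight_pos m a).le
  rw [lp.coeFn_smul, Pi.smul_apply, norm_smul]
  exact pow_le_pow_left₀ (by positivity) (mul_le_of_le_one_left (norm_nonneg _) hz) 2

theorem isCompact_sobolevBall (n : ℕ) (hm : 0 < m) : IsCompact (sobolevBall n m) := by
  have : sobolevBall n m = fourierEquiv n ⁻¹' fourierEllipsoid n m :=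
    Set.ext fun f => mem_sobolevBall_iff
  rw [this]
  exact (fourierEquiv n).toHomeomorph.isCompact_preimage.2 (isCompact_fourierEllipsoid n hm)

end Ellipsoid

/-! ### Monomials and the cone they generate on the ellipsoid -/

section Monomials

open scoped NNReal

variable {n m N : ℕ}

theorem continuous_seqMonomial (s : Multiset (Fin n → ℤ)) : Continuous (seqMonomial s) :=
  continuous_multiset_prod s fun a _ => continuous_coord a

theorem seqMonomial_fourierEquiv (s : Multiset (Fin n → ℤ)) (f : TorusL2 n) :
    seqMonomial s (fourierEquiv n f) = functionMonomial s f := by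
  simp only [seqMonomial, functionMonomial, fourierEquiv_apply]

theorem continuous_functionMonomial (s : Multiset (Fin n → ℤ)) :
    Continuous (functionMonomial s) := by
  have : functionMonomial s = seqMonomial s ∘ fourierEquiv n :=
    funext fun f => (seqMonomial_fourierEquiv s f).symm
  rw [this]
  exact (continuous_seqMonomial s).comp (fourierEquiv n).continuous

theorem seqMonomial_smul (s : Multiset (Fin n → ℤ)) (z : ℂ) (c : SeqL2 n) :
    seqMonomial s (z • c) = z ^ s.card * seqMonomial s c := by
  simp [seqMonomial, Multiset.prod_map_mul]

/-- The vector of all monomials of the family `A`. -/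
def monomialVector (A : Fin N → Multiset (Fin n → ℤ)) (c : SeqL2 n) : Fin N → ℂ :=
  fun k => seqMonomial (A k) c

theorem continuous_monomialVector (A : Fin N → Multiset (Fin n → ℤ)) :
    Continuous (monomialVector A) :=
  continuous_pi fun k => continuous_seqMonomial (A k)

/-- The convex cone generated by the monomial vectors of the points of the ellipsoid. -/
def pointCone (m : ℕ) (A : Fin N → Multiset (Fin n → ℤ)) : Submodule ℝ≥0 (Fin N → ℂ) :=
  Submodule.span ℝ≥0 (monomialVector A '' fourierEllipsoid n m)

theorem monomialVector_mem_pointCone (A : Fin N → Multiset (Fin n → ℤ)) {c : SeqL2 n}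
    (hc : c ∈ fourierEllipsoid n m) : monomialVector A c ∈ pointCone m A :=
  Submodule.subset_span ⟨c, hc, rfl⟩

/-- Rotation by `ζ` multiplies a monomial of degree `d` by `ζ ^ d`. With `M` above all the degrees,
which are positive, the sum over all rotations by `M`-th roots of unity vanishes, so the negative is
the sum over the nontrivial ones. -/
theorem neg_monomialVector_mem_pointCone {A : Fin N → Multiset (Fin n → ℤ)}
    (hA : ∀ k, A k ≠ 0) {c : SeqL2 n} (hc : c ∈ fourierEllipsoid n m) :
    -monomialVector A c ∈ pointCone m A := by
  let M : ℕ := (∑ k, (A k).card) + 1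
  let ζ : ℂ := Complex.exp (2 * Real.pi * Complex.I / M)
  have hζ : IsPrimitiveRoot ζ M := Complex.isPrimitiveRoot_exp M (Nat.succ_ne_zero _)
  have hnorm : ‖ζ‖ = 1 := hζ.norm'_eq_one (Nat.succ_ne_zero _)
  have hsum : ∑ j ∈ Finset.range M, monomialVector A (ζ ^ j • c) = 0 := by
    funext k
    have h1 : 0 < (A k).card := Multiset.card_pos.2 (hA k)
    have h2 : (A k).card < M := Nat.lt_succ_of_le
      (Finset.single_le_sum (f := fun k => (A k).card) (fun _ _ => Nat.zero_le _)
        (Finset.mem_univ k))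
    have h3 : ζ ^ (A k).card ≠ 1 := hζ.pow_ne_one_of_pos_of_lt h1.ne' h2
    have h4 : ∑ j ∈ Finset.range M, (ζ ^ (A k).card) ^ j = 0 := by
      have h5 := mul_geom_sum (ζ ^ (A k).card) M
      rw [← pow_mul, mul_comm (A k).card M, pow_mul, hζ.pow_eq_one, one_pow, sub_self] at h5
      exact (mul_eq_zero.1 h5).resolve_left (sub_ne_zero.2 h3)
    simp only [Finset.sum_apply, monomialVector, seqMonomial_smul, ← Finset.sum_mul, Pi.zero_apply]
    simp only [← pow_mul, mul_comm _ (A k).card] at h4 ⊢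
    rw [h4, zero_mul]
  rw [Finset.sum_range_succ'] at hsum
  rw [pow_zero, one_smul] at hsum
  rw [← eq_neg_of_add_eq_zero_left hsum]
  exact sum_mem fun j _ => monomialVector_mem_pointCone A
    (smul_mem_fourierEllipsoid hc (by rw [norm_pow, hnorm, one_pow]))

theorem isClosed_pointCone (hm : 0 < m) (A : Fin N → Multiset (Fin n → ℤ)) :
    IsClosed (pointCone m A : Set (Fin N → ℂ)) := by
  by_cases hA : ∀ k, A k ≠ 0
  · refine isClosed_span_nnreal_of_neg_mem ?_
    rintro _ ⟨c, hc, rfl⟩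
    exact neg_monomialVector_mem_pointCone hA hc
  · push Not at hA
    obtain ⟨k, hk⟩ := hA
    refine isClosed_span_nnreal_of_functional
      ((isCompact_fourierEllipsoid n hm).image (continuous_monomialVector A))
      (Complex.reCLM.comp (ContinuousLinearMap.proj k)) ?_
    rintro _ ⟨c, -, rfl⟩
    simp [monomialVector, seqMonomial, hk]

end Monomials

/-! ### The moment cone is the cone of point evaluations -/

section MomentCone

open scoped NNReal

variable {n m N : ℕ}

theorem pi_integral_apply {X ι : Type*} [Fintype ι] [MeasurableSpace X] {μ : Measure X}
    {g : X → ι → ℂ} (hg : Integrable g μ) (k : ι) : (∫ x, g x ∂μ) k = ∫ x, g x k ∂μ :=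
  ((ContinuousLinearMap.proj (R := ℝ) (φ := fun _ : ι => ℂ) k).integral_comp_comm hg).symm

/-- The average lies in a closed convex set containing the values; the integral is a nonnegative
multiple of it. -/
theorem setIntegral_mem_of_isClosed_cone {X F : Type*} [MeasurableSpace X] [NormedAddCommGroup F]
    [NormedSpace ℝ F] [CompleteSpace F] {D : Submodule ℝ≥0 F} (hD : IsClosed (D : Set F))
    {μ : Measure X} {s : Set X} (hs : MeasurableSet s) (hμ : μ s ≠ ⊤) {g : X → F}
    (hg : IntegrableOn g s μ) (hgD : ∀ x ∈ s, g x ∈ D) : ∫ x in s, g x ∂μ ∈ D := by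
  by_cases h0 : μ s = 0
  · rw [setIntegral_measure_zero g h0]
    exact zero_mem D
  have hconv : Convex ℝ (D : Set F) := fun x hx y hy a b ha hb _ =>
    add_mem (Submodule.smul_mem D (⟨a, ha⟩ : ℝ≥0) hx) (Submodule.smul_mem D (⟨b, hb⟩ : ℝ≥0) hy)
  have h1 := hconv.set_average_mem hD h0 hμ (ae_restrict_of_forall_mem hs hgD) hg
  rw [← measure_smul_setAverage g hμ]
  exact Submodule.smul_mem D (⟨μ.real s, measureReal_nonneg⟩ : ℝ≥0) h1

theorem momentCone_subset_pointCone (hm : 0 < m) (A : Fin N → Multiset (Fin n → ℤ)) :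
    momentCone m A ⊆ pointCone m A := by
  rintro y ⟨μ, hμ, -, -, hy⟩
  have hB := isCompact_sobolevBall n hm
  have hcont : Continuous fun f : TorusL2 n => monomialVector A (fourierEquiv n f) :=
    (continuous_monomialVector A).comp (fourierEquiv n).continuous
  have hint := hcont.continuousOn.integrableOn_compact (μ := μ) hB
  have hyv : y = ∫ f in sobolevBall n m, monomialVector A (fourierEquiv n f) ∂μ := by
    funext k
    rw [hy k, pi_integral_apply hint]
    simp only [monomialVector, seqMonomial_fourierEquiv]
  rw [hyv]
  exact setIntegral_mem_of_isClosed_cone (isClosed_pointCone hm A) hB.measurableSet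
    hB.measure_lt_top.ne hint fun f hf =>
      monomialVector_mem_pointCone A (mem_sobolevBall_iff.1 hf)

theorem innerRegular_of_isFiniteMeasure (μ : Measure (TorusL2 n)) [IsFiniteMeasure μ] :
    μ.InnerRegular := by
  have : Fact ((2 : ℝ≥0∞) ≠ ⊤) := ⟨by norm_num⟩
  have : SecondCountableTopology UnitAddCircle := EMetric.secondCountable_of_sigmaCompact _
  have : SecondCountableTopology (TorusL2 n) := Lp.SecondCountableTopology
  infer_instance

theorem pointCone_subset_momentCone (hm : 0 < m) (A : Fin N → Multiset (Fin n → ℤ)) :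
    (pointCone m A : Set (Fin N → ℂ)) ⊆ momentCone m A := by
  have hB := isCompact_sobolevBall n hm
  have hint (k : Fin N) (μ : Measure (TorusL2 n)) [IsFiniteMeasure μ] :
      IntegrableOn (functionMonomial (A k)) (sobolevBall n m) μ :=
    (continuous_functionMonomial (A k)).continuousOn.integrableOn_compact hB
  -- Finiteness passes through the span induction and gives integrability; inner regularity is
  -- recovered from it at the end.
  suffices h : ∀ y ∈ pointCone m A, ∃ μ : Measure (TorusL2 n), IsFiniteMeasure μ ∧
      μ (sobolevBall n m)ᶜ = 0 ∧
      ∀ k, y k = ∫ f in sobolevBall n m, functionMonomial (A k) f ∂μ by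
    intro y hy
    obtain ⟨μ, hfin, h0, hk⟩ := h y hy
    exact ⟨μ, inferInstance, innerRegular_of_isFiniteMeasure μ, h0, hk⟩
  intro y hy
  induction hy using Submodule.span_induction with
  | mem x hx =>
    obtain ⟨_, ⟨f, hf, hc⟩, rfl⟩ := hx
    refine ⟨Measure.dirac f, inferInstance, ?_, fun k => ?_⟩
    · rw [Measure.dirac_apply' _ hB.measurableSet.compl]
      simp [hf]
    · classical
      rw [setIntegral_dirac, if_pos hf]
      simp only [monomialVector, seqMonomial, functionMonomial, hc]
  | zero => exact ⟨0, inferInstance, by simp, by simp⟩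
  | add x y _ _ hx hy =>
    obtain ⟨μ, hμ, hμ0, hμk⟩ := hx
    obtain ⟨ν, hν, hν0, hνk⟩ := hy
    refine ⟨μ + ν, inferInstance, by simp [hμ0, hν0], fun k => ?_⟩
    rw [Measure.restrict_add, integral_add_measure (hint k μ) (hint k ν), Pi.add_apply, hμk, hνk]
  | smul t x _ hx =>
    obtain ⟨μ, hμ, hμ0, hμk⟩ := hx
    refine ⟨t • μ, inferInstance, by simp [hμ0], fun k => ?_⟩
    rw [Measure.restrict_smul, integral_smul_nnreal_measure, Pi.smul_apply, hμk]

theorem momentCone_eq_pointCone (hm : 0 < m) (A : Fin N → Multiset (Fin n → ℤ)) :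
    momentCone m A = pointCone m A :=
  (momentCone_subset_pointCone hm A).antisymm (pointCone_subset_momentCone hm A)

end MomentCone

/-! ### Densities from the quadratic module -/

section QuadraticModule

variable {n m N : ℕ}

theorem analyticPolys_subset_conjPolys (n r ρ : ℕ) : analyticPolys n r ρ ⊆ conjPolys n r ρ := by
  rintro g ⟨q, hr, hρ, hg⟩
  refine ⟨MvPolynomial.rename Sum.inl q, (MvPolynomial.totalDegree_rename_le _ _).trans hr, ?_, ?_⟩
  · intro v hv
    classical
    obtain ⟨a, ha, rfl⟩ := Finset.mem_image.1 (MvPolynomial.vars_rename _ _ hv)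
    exact hρ a ha
  · intro c
    rw [hg, MvPolynomial.eval_rename]
    rfl

theorem analyticPolys_mono {r r' ρ ρ' : ℕ} (hr : r ≤ r') (hρ : ρ ≤ ρ') :
    analyticPolys n r ρ ⊆ analyticPolys n r' ρ' :=
  fun _ ⟨q, hq, hv, hg⟩ => ⟨q, hq.trans hr, fun a ha => (hv a ha).trans hρ, hg⟩

theorem continuous_of_mem_conjPolys {r ρ : ℕ} {g : SeqL2 n → ℂ} (hg : g ∈ conjPolys n r ρ) :
    Continuous g := by
  obtain ⟨q, -, -, hq⟩ := hg
  rw [funext hq]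
  refine (MvPolynomial.continuous_eval q).comp (continuous_pi fun v => ?_)
  rcases v with a | a
  · exact continuous_coord a
  · exact Complex.continuous_conj.comp (continuous_coord a)

theorem sumsOfSquares_mono {V W : Set (SeqL2 n → ℂ)} (h : V ⊆ W) :
    sumsOfSquares V ⊆ sumsOfSquares W :=
  fun _ ⟨l, q, hq, hs⟩ => ⟨l, q, fun k => h (hq k), hs⟩

theorem fullQuadraticModule_mono {V W : ℕ → ℕ → Set (SeqL2 n → ℂ)} (h : ∀ r ρ, V r ρ ⊆ W r ρ) :
    fullQuadraticModule m V ⊆ fullQuadraticModule m W := by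
  refine Set.iUnion₂_mono fun r ρ => ?_
  rintro p ⟨s₀, hs₀, s₁, hs₁, hp⟩
  refine ⟨s₀, sumsOfSquares_mono (h r ρ) hs₀, s₁, ?_, hp⟩
  cases r with
  | zero => exact hs₁
  | succ r => exact sumsOfSquares_mono (h r ρ) hs₁

theorem continuous_of_mem_sumsOfSquares {V : Set (SeqL2 n → ℂ)} (hV : ∀ g ∈ V, Continuous g)
    {s : SeqL2 n → ℝ} (hs : s ∈ sumsOfSquares V) : Continuous s := by
  obtain ⟨l, q, hq, hs⟩ := hs
  rw [funext hs]
  exact continuous_finsetSum _ fun k _ => (hV _ (hq k)).norm.pow 2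

theorem nonneg_of_mem_sumsOfSquares {V : Set (SeqL2 n → ℂ)} {s : SeqL2 n → ℝ}
    (hs : s ∈ sumsOfSquares V) (c : SeqL2 n) : 0 ≤ s c := by
  obtain ⟨l, q, -, hs⟩ := hs
  rw [hs]
  exact Finset.sum_nonneg fun k _ => sq_nonneg _

theorem continuous_and_nonneg_of_mem_fullQuadraticModule {V : ℕ → ℕ → Set (SeqL2 n → ℂ)}
    (hV : ∀ r ρ, ∀ g ∈ V r ρ, Continuous g) {p : SeqL2 n → ℝ}
    (hp : p ∈ fullQuadraticModule m V) :
    Continuous p ∧ ∀ c ∈ fourierEllipsoid n m, 0 ≤ p c := by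
  obtain ⟨r, ρ, s₀, hs₀, s₁, hs₁, hp⟩ := Set.mem_iUnion₂.1 hp
  have h₁ : Continuous s₁ ∧ ∀ c, 0 ≤ s₁ c := by
    cases r with
    | zero =>
      rw [Set.mem_singleton_iff.1 hs₁]
      exact ⟨continuous_const, fun _ => le_rfl⟩
    | succ r =>
      exact ⟨continuous_of_mem_sumsOfSquares (hV r ρ) hs₁, nonneg_of_mem_sumsOfSquares hs₁⟩
  refine ⟨?_, fun c hc => ?_⟩
  · rw [funext hp]
    refine (continuous_of_mem_sumsOfSquares (hV r ρ) hs₀).add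
      (h₁.1.mul (continuous_const.sub (continuous_finsetSum _ fun a _ => ?_)))
    exact ((continuous_coord a).norm.pow 2).const_mul _
  · rw [hp]
    exact add_nonneg (nonneg_of_mem_sumsOfSquares hs₀ c)
      (mul_nonneg (h₁.2 c) (sub_nonneg.2 (mem_fourierEllipsoid_iff.1 hc _)))

/-- The vector of moments of the measure with density `p` with respect to `γ` on `E`. -/
def densityMoment (m : ℕ) (γ : Measure (SeqL2 n)) (A : Fin N → Multiset (Fin n → ℤ))
    (p : SeqL2 n → ℝ) : Fin N → ℂ :=
  ∫ c in fourierEllipsoid n m, p c • monomialVector A c ∂γ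

theorem integrableOn_smul_monomialVector (hm : 0 < m) (γ : Measure (SeqL2 n))
    [IsLocallyFiniteMeasure γ] (A : Fin N → Multiset (Fin n → ℤ)) {p : SeqL2 n → ℝ}
    (hp : Continuous p) :
    IntegrableOn (fun c => p c • monomialVector A c) (fourierEllipsoid n m) γ :=
  (hp.smul (continuous_monomialVector A)).continuousOn.integrableOn_compact
    (isCompact_fourierEllipsoid n hm)

theorem densityMoment_apply (hm : 0 < m) (γ : Measure (SeqL2 n)) [IsLocallyFiniteMeasure γ]
    (A : Fin N → Multiset (Fin n → ℤ)) {p : SeqL2 n → ℝ} (hp : Continuous p) (k : Fin N) :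
    densityMoment m γ A p k =
      ∫ c in fourierEllipsoid n m, seqMonomial (A k) c * (p c : ℂ) ∂γ := by
  rw [densityMoment, pi_integral_apply (integrableOn_smul_monomialVector hm γ A hp)]
  refine integral_congr_ae (Filter.Eventually.of_forall fun c => ?_)
  simp only [Pi.smul_apply, monomialVector, Complex.real_smul, mul_comm]

theorem innerCone_subset_pointCone (hm : 0 < m) (γ : Measure (SeqL2 n))
    [IsLocallyFiniteMeasure γ] (A : Fin N → Multiset (Fin n → ℤ)) {Q : Set (SeqL2 n → ℝ)}
    (hQ : ∀ p ∈ Q, Continuous p ∧ ∀ c ∈ fourierEllipsoid n m, 0 ≤ p c) :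
    innerCone m γ Q A ⊆ pointCone m A := by
  rintro y ⟨p, hp, hy⟩
  obtain ⟨hcont, hnn⟩ := hQ p hp
  have hE := isCompact_fourierEllipsoid n hm
  have hyv : y = densityMoment m γ A p :=
    funext fun k => (hy k).trans (densityMoment_apply hm γ A hcont k).symm
  rw [hyv]
  exact setIntegral_mem_of_isClosed_cone (isClosed_pointCone hm A) hE.measurableSet
    hE.measure_lt_top.ne (integrableOn_smul_monomialVector hm γ A hcont) fun c hc =>
      Submodule.smul_mem _ (⟨p c, hnn c hc⟩ : NNReal) (monomialVector_mem_pointCone A hc)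

end QuadraticModule

/-! ### Peaking densities -/

section Peak

theorem exists_pow_mul_lt {θ θ' α M : ℝ} (h0 : 0 ≤ θ) (h1 : θ < θ') (hα : 0 < α) (hM : 0 ≤ M) :
    ∃ k : ℕ, M * θ ^ k < α * θ' ^ k := by
  have hθ' : 0 < θ' := h0.trans_lt h1
  obtain ⟨k, hk⟩ := exists_pow_lt_of_lt_one (show 0 < α / (M + 1) by positivity)
    ((div_lt_one hθ').2 h1)
  refine ⟨k, ?_⟩
  rw [div_pow, div_lt_div_iff₀ (by positivity) (by positivity)] at hk
  nlinarith [pow_nonneg h0 k]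

/-- Powers of a peaking function concentrate the integral at the points where it peaks. -/
theorem exists_setIntegral_mul_pow_pos {X : Type*} [TopologicalSpace X] [T2Space X]
    [MeasurableSpace X] [BorelSpace X] {γ : Measure X} [IsFiniteMeasureOnCompacts γ] {s : Set X}
    (hs : IsCompact s) (hopen : ∀ U : Set X, IsOpen U → (U ∩ s).Nonempty → 0 < γ (U ∩ s))
    {h φ : X → ℝ} (hh : Continuous h) (hφ : Continuous φ) (hφ0 : ∀ x, 0 ≤ φ x)
    (hφ1 : ∀ x ∈ s, φ x ≤ 1) {c : X} (hc : c ∈ s) (hφc : φ c = 1) (hhc : 0 < h c)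
    (hpeak : ∀ x ∈ s, φ x = 1 → h x = h c) : ∃ k : ℕ, 0 < ∫ x in s, h x * φ x ^ k ∂γ := by
  have hγ : γ s ≠ ⊤ := hs.measure_lt_top.ne
  set α := h c / 2 with hα
  have hα0 : 0 < α := half_pos hhc
  have hK : IsCompact (s ∩ {x | h x ≤ α}) :=
    hs.inter_right (isClosed_le hh continuous_const)
  -- At peak points `h = h c > α`, so `φ` stays strictly below `1` on the compact set where `h ≤ α`.
  obtain ⟨θ, hθ0, hθ1, hθ⟩ : ∃ θ : ℝ, 0 ≤ θ ∧ θ < 1 ∧ ∀ x ∈ s, h x ≤ α → φ x ≤ θ := by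
    rcases (s ∩ {x | h x ≤ α}).eq_empty_or_nonempty with he | hne
    · refine ⟨0, le_rfl, zero_lt_one, fun x hx hxα => ?_⟩
      have : x ∈ s ∩ {x | h x ≤ α} := ⟨hx, hxα⟩
      rw [he] at this
      exact this.elim
    · obtain ⟨z, ⟨hzs, hzα⟩, hz⟩ := hK.exists_isMaxOn hne hφ.continuousOn
      refine ⟨φ z, hφ0 z, lt_of_le_of_ne (hφ1 z hzs) fun h1 => ?_, fun x hx hxα => hz ⟨hx, hxα⟩⟩
      have h2 : h z ≤ α := hzα
      rw [hpeak z hzs h1] at h2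
      linarith
  obtain ⟨θ', hθθ', hθ'1⟩ := exists_between hθ1
  have hθ'0 : 0 < θ' := hθ0.trans_lt hθθ'
  obtain ⟨M, hM⟩ := hs.exists_bound_of_continuousOn hh.continuousOn
  have hM0 : 0 ≤ M := (norm_nonneg _).trans (hM c hc)
  set V := {x | θ' < φ x} ∩ s with hV
  have hVopen : IsOpen {x | θ' < φ x} := isOpen_lt continuous_const hφ
  have hVpos : 0 < γ.real V := by
    refine ENNReal.toReal_pos (hopen _ hVopen ⟨c, ?_, hc⟩).ne'
      (measure_ne_top_of_subset Set.inter_subset_right hγ)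
    simpa [hφc] using hθ'1
  have hVmeas : MeasurableSet V := hVopen.measurableSet.inter hs.measurableSet
  -- The gain on `V` is at least `α θ' ^ k γ(V)` and the loss where `h ≤ α` at most `M θ ^ k γ(s)`;
  -- since `θ < θ'`, the gain wins for suitable `k`.
  obtain ⟨k, hk⟩ := exists_pow_mul_lt hθ0 hθθ' (mul_pos hα0 hVpos)
    (mul_nonneg hM0 (measureReal_nonneg (μ := γ) (s := s)))
  refine ⟨k, ?_⟩
  have hint1 : IntegrableOn (V.indicator fun _ => α * θ' ^ k) s γ :=
    (integrableOn_const hγ).indicator hVmeas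
  have hint2 : IntegrableOn (fun _ => M * θ ^ k) s γ := integrableOn_const hγ
  have hle : ∫ x in s, (V.indicator (fun _ => α * θ' ^ k) x - M * θ ^ k) ∂γ ≤
      ∫ x in s, h x * φ x ^ k ∂γ := by
    refine setIntegral_mono_on (hint1.sub hint2)
      ((hh.mul (hφ.pow k)).continuousOn.integrableOn_compact' hs hs.measurableSet)
      hs.measurableSet fun x hx => ?_
    have hMθ : 0 ≤ M * θ ^ k := by positivity
    by_cases hxV : x ∈ V
    · rw [Set.indicator_of_mem hxV]
      have hxα : α < h x := by
        by_contra! hcon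
        exact absurd (hθ x hx hcon) (not_le.2 (hθθ'.trans hxV.1))
      have := mul_le_mul hxα.le (pow_le_pow_left₀ hθ'0.le hxV.1.le k) (by positivity)
        (hα0.le.trans hxα.le)
      linarith
    · rw [Set.indicator_of_notMem hxV]
      rcases le_or_gt (h x) α with hxα | hxα
      · have h1 : -M ≤ h x := (abs_le.1 (hM x hx)).1
        have h2 : φ x ^ k ≤ θ ^ k := pow_le_pow_left₀ (hφ0 x) (hθ x hx hxα) k
        have h3 : 0 ≤ φ x ^ k := pow_nonneg (hφ0 x) k
        have h4 : -M * φ x ^ k ≤ h x * φ x ^ k := mul_le_mul_of_nonneg_right h1 h3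
        have h5 : M * φ x ^ k ≤ M * θ ^ k := mul_le_mul_of_nonneg_left h2 hM0
        linarith
      · have := mul_nonneg (hα0.le.trans hxα.le) (pow_nonneg (hφ0 x) k)
        linarith
  refine lt_of_lt_of_le ?_ hle
  rw [integral_sub hint1 hint2, setIntegral_indicator hVmeas, setIntegral_const,
    setIntegral_const, Set.inter_eq_self_of_subset_right Set.inter_subset_right]
  simp only [smul_eq_mul]
  linarith

/-- Maximum modulus principle for `exp ∘ f`, whose modulus is `exp (Re f)`. -/
theorem re_nonpos_of_re_nonpos_on_circle {f : ℂ → ℂ} (hf : Differentiable ℂ f)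
    (h : ∀ z, ‖z‖ = 1 → (f z).re ≤ 0) {z : ℂ} (hz : ‖z‖ ≤ 1) : (f z).re ≤ 0 := by
  have h1 : ‖Complex.exp (f z)‖ ≤ 1 := by
    refine Complex.norm_le_of_forall_mem_frontier_norm_le (U := Metric.ball (0 : ℂ) 1)
      Metric.isBounded_ball (hf.cexp).diffContOnCl (fun w hw => ?_) ?_
    · rw [frontier_ball _ one_ne_zero, mem_sphere_zero_iff_norm] at hw
      rw [Complex.norm_exp]
      exact Real.exp_le_one_iff.2 (h w hw)
    · rw [closure_ball _ one_ne_zero, mem_closedBall_zero_iff]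
      exact hz
  rw [Complex.norm_exp] at h1
  exact Real.exp_le_one_iff.1 h1

variable {n m N : ℕ}

/-- A polynomial of modulus at most `1` on the ellipsoid, peaking exactly at the points which agree
with `v` on `S`. -/
def peakFunction (m : ℕ) (S : Finset (Fin n → ℤ)) (v : (Fin n → ℤ) → ℂ) (c : SeqL2 n) : ℂ :=
  2⁻¹ * (1 + ∑ a ∈ S, weight m a * starRingEnd ℂ (v a) * c a)

/-- With `L` the weighted pairing of `v` and `c`, the left side is `(1 + |L|² + 2 Re L) / 4`. Here
`|L| ≤ 1` by the termwise arithmetic–geometric mean inequality, and polarization bounds `2 Re L` by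
`2` minus the squared weighted distance. -/
theorem norm_peakFunction_sq_le {S : Finset (Fin n → ℤ)} {v : (Fin n → ℤ) → ℂ}
    (hv : ∑ a ∈ S, weight m a * ‖v a‖ ^ 2 = 1) {c : SeqL2 n} (hc : c ∈ fourierEllipsoid n m) :
    ‖peakFunction m S v c‖ ^ 2 ≤ 1 - (∑ a ∈ S, weight m a * ‖c a - v a‖ ^ 2) / 4 := by
  have hcS := mem_fourierEllipsoid_iff.1 hc S
  set L : ℂ := ∑ a ∈ S, weight m a * starRingEnd ℂ (v a) * c a with hL
  have hre : L.re = ∑ a ∈ S, weight m a * (starRingEnd ℂ (v a) * c a).re := by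
    rw [hL, Complex.re_sum]
    refine Finset.sum_congr rfl fun a _ => ?_
    rw [mul_assoc, Complex.re_ofReal_mul]
  have hdist : ∑ a ∈ S, weight m a * ‖c a - v a‖ ^ 2 =
      ∑ a ∈ S, weight m a * ‖c a‖ ^ 2 + ∑ a ∈ S, weight m a * ‖v a‖ ^ 2 - 2 * L.re := by
    rw [hre, Finset.mul_sum, ← Finset.sum_add_distrib, ← Finset.sum_sub_distrib]
    refine Finset.sum_congr rfl fun a _ => ?_
    simp only [← Complex.normSq_eq_norm_sq, Complex.normSq_sub]
    rw [mul_comm (c a)]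
    ring
  have hLn : ‖L‖ ≤ 1 := by
    calc ‖L‖ ≤ ∑ a ∈ S, ‖weight m a * starRingEnd ℂ (v a) * c a‖ := norm_sum_le _ _
      _ ≤ ∑ a ∈ S, (weight m a * ‖v a‖ ^ 2 + weight m a * ‖c a‖ ^ 2) / 2 := by
        refine Finset.sum_le_sum fun a _ => ?_
        rw [norm_mul, norm_mul, Complex.norm_real, RCLike.norm_conj,
          Real.norm_of_nonneg (weight_pos m a).le]
        nlinarith [mul_nonneg (weight_pos m a).le (sq_nonneg (‖v a‖ - ‖c a‖))]
      _ ≤ 1 := by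
        rw [← Finset.sum_div, Finset.sum_add_distrib]
        linarith
  have hsq : ‖(1 : ℂ) + L‖ ^ 2 = 1 + ‖L‖ ^ 2 + 2 * L.re := by
    simp only [← Complex.normSq_eq_norm_sq, Complex.normSq_add]
    simp
  have hpk : ‖peakFunction m S v c‖ ^ 2 = ‖(1 : ℂ) + L‖ ^ 2 / 4 := by
    rw [peakFunction, norm_mul, mul_pow, norm_inv, RCLike.norm_ofNat]
    ring
  rw [hpk, hsq, hdist, hv]
  have : ‖L‖ ^ 2 ≤ 1 := pow_le_one₀ (norm_nonneg _) hLn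
  linarith

theorem peakFunction_finiteSeq {S : Finset (Fin n → ℤ)} {v : (Fin n → ℤ) → ℂ}
    (hv : ∑ a ∈ S, weight m a * ‖v a‖ ^ 2 = 1) : peakFunction m S v (finiteSeq S v) = 1 := by
  have h : ∑ a ∈ S, (weight m a : ℂ) * starRingEnd ℂ (v a) * finiteSeq S v a = 1 := by
    rw [← Complex.ofReal_one, ← hv, Complex.ofReal_sum]
    refine Finset.sum_congr rfl fun a ha => ?_
    rw [finiteSeq_apply, if_pos ha, mul_assoc, Complex.conj_mul']
    push_cast
    rfl
  rw [peakFunction, h]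
  norm_num

theorem peakFunction_pow_mem_analyticPolys (m ρ k : ℕ) (v : (Fin n → ℤ) → ℂ) :
    ∃ r, (fun c => peakFunction m (harmonicBox n ρ) v c ^ k) ∈ analyticPolys n r ρ := by
  let P : MvPolynomial (Fin n → ℤ) ℂ :=
    (MvPolynomial.C 2⁻¹ * (1 + ∑ a ∈ harmonicBox n ρ,
      MvPolynomial.C (weight m a * starRingEnd ℂ (v a)) * MvPolynomial.X a)) ^ k
  refine ⟨P.totalDegree, P, le_rfl, fun a ha => ?_, fun c => ?_⟩
  · have hP : P ∈ MvPolynomial.supported ℂ (harmonicBox n ρ : Set (Fin n → ℤ)) := by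
      refine pow_mem (mul_mem (Subalgebra.algebraMap_mem _ _)
        (add_mem (one_mem _) (sum_mem fun a ha => mul_mem (Subalgebra.algebraMap_mem _ _) ?_))) k
      exact MvPolynomial.X_mem_supported.2 ha
    exact (mem_harmonicBox a).1 (MvPolynomial.mem_supported.1 hP ha)
  · simp [P, peakFunction]

theorem monomialVector_congr {A : Fin N → Multiset (Fin n → ℤ)} {S : Finset (Fin n → ℤ)}
    (hS : ∀ k, ∀ a ∈ A k, a ∈ S) {c c' : SeqL2 n} (h : ∀ a ∈ S, c a = c' a) :
    monomialVector A c = monomialVector A c' := by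
  funext k
  exact congrArg Multiset.prod (Multiset.map_congr rfl fun a ha => h a (hS k a ha))

theorem exists_harmonicBox (A : Fin N → Multiset (Fin n → ℤ)) :
    ∃ ρ, ∀ k, ∀ a ∈ A k, a ∈ harmonicBox n ρ := by
  classical
  refine ⟨Finset.univ.sup fun k => (A k).toFinset.sup harmonicDegree, fun k a ha => ?_⟩
  rw [mem_harmonicBox]
  exact (Finset.le_sup (f := harmonicDegree) (Multiset.mem_toFinset.2 ha)).trans
    (Finset.le_sup (f := fun k => (A k).toFinset.sup harmonicDegree) (Finset.mem_univ k))

theorem differentiable_monomialVector_smul (A : Fin N → Multiset (Fin n → ℤ)) (c : SeqL2 n) :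
    Differentiable ℂ fun z : ℂ => monomialVector A (z • c) := by
  refine differentiable_pi.2 fun k => ?_
  simp only [monomialVector, seqMonomial_smul]
  fun_prop

/-- The maximum principle: positivity of a functional of the monomials at some point of the
ellipsoid propagates to a finitely supported boundary point. -/
theorem exists_boundary_point {A : Fin N → Multiset (Fin n → ℤ)} {ρ : ℕ}
    (hρ : ∀ k, ∀ a ∈ A k, a ∈ harmonicBox n ρ) (F : StrongDual ℂ (Fin N → ℂ)) {c : SeqL2 n}
    (hc : c ∈ fourierEllipsoid n m) (hF : 0 < (F (monomialVector A c)).re) :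
    ∃ v : (Fin n → ℤ) → ℂ, ∑ a ∈ harmonicBox n ρ, weight m a * ‖v a‖ ^ 2 = 1 ∧
      0 < (F (monomialVector A (finiteSeq (harmonicBox n ρ) v))).re := by
  set S := harmonicBox n ρ with hS
  -- On `S` the point `c` is written as `z • u` with `u` of weighted norm `1`, placing it on a
  -- complex disc through the origin. If `c` vanishes on `S`, any unit `u` serves; index `0` has
  -- weight `1`.
  obtain ⟨z, u, hz, hu, hcu⟩ : ∃ (z : ℂ) (u : (Fin n → ℤ) → ℂ), ‖z‖ ≤ 1 ∧
      ∑ a ∈ S, weight m a * ‖u a‖ ^ 2 = 1 ∧ ∀ a ∈ S, c a = z * u a := by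
    have hcS := mem_fourierEllipsoid_iff.1 hc S
    set t := ∑ a ∈ S, weight m a * ‖c a‖ ^ 2 with ht
    have hnn : ∀ a ∈ S, 0 ≤ weight m a * ‖c a‖ ^ 2 := fun a _ =>
      mul_nonneg (weight_pos m a).le (sq_nonneg _)
    rcases (Finset.sum_nonneg hnn).eq_or_lt with h0 | h0
    · refine ⟨0, Pi.single 0 1, by simp, ?_, fun a ha => ?_⟩
      · have h0S : (0 : Fin n → ℤ) ∈ S := by
          rw [hS, mem_harmonicBox]
          simp [harmonicDegree]
        rw [Finset.sum_eq_single_of_mem 0 h0S fun a _ ha => by simp [ha]]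
        simp [weight]
      · have h1 := (Finset.sum_eq_zero_iff_of_nonneg hnn).1 h0.symm a ha
        simpa [(weight_pos m a).ne'] using h1
    · have ht0 : 0 < t := h0
      have hsq : 0 < √t := Real.sqrt_pos.2 ht0
      refine ⟨(√t : ℝ), fun a => (√t : ℂ)⁻¹ * c a, ?_, ?_, fun a _ => ?_⟩
      · rw [Complex.norm_real, Real.norm_of_nonneg hsq.le]
        exact Real.sqrt_le_one.2 hcS
      · have h1 : ∀ a, weight m a * ‖(√t : ℂ)⁻¹ * c a‖ ^ 2 = t⁻¹ * (weight m a * ‖c a‖ ^ 2) := by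
          intro a
          rw [norm_mul, norm_inv, Complex.norm_real, Real.norm_of_nonneg hsq.le, mul_pow, inv_pow,
            Real.sq_sqrt ht0.le]
          ring
        simp only [h1]
        rw [← Finset.mul_sum, inv_mul_cancel₀ ht0.ne']
      · rw [mul_inv_cancel_left₀ (Complex.ofReal_ne_zero.2 hsq.ne')]
  by_contra! hcon
  refine absurd hF (not_lt.2 ?_)
  have hmv : monomialVector A c = monomialVector A (z • finiteSeq S u) := by
    refine monomialVector_congr hρ fun a ha => ?_
    rw [lp.coeFn_smul, Pi.smul_apply, finiteSeq_apply, if_pos ha, hcu a ha, smul_eq_mul]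
  rw [hmv]
  refine re_nonpos_of_re_nonpos_on_circle
    (f := fun z => F (monomialVector A (z • finiteSeq S u)))
    (F.differentiable.comp (differentiable_monomialVector_smul A _)) (fun w hw => ?_) hz
  -- On the unit circle the rotation is absorbed into `u`, which stays on the boundary, so the
  -- negated claim applies there.
  have hw' : monomialVector A (w • finiteSeq S u) =
      monomialVector A (finiteSeq S fun a => w * u a) := by
    refine monomialVector_congr hρ fun a ha => ?_
    rw [lp.coeFn_smul, Pi.smul_apply, finiteSeq_apply, finiteSeq_apply, if_pos ha, if_pos ha,
      smul_eq_mul]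
  simp only [hw']
  exact hcon _ (by simpa [hw] using hu)

/-- A functional which is positive at some monomial vector is positive at the moment vector of some
squared modulus of an analytic polynomial. -/
theorem exists_densityMoment_pos (hm : 0 < m) {γ : Measure (SeqL2 n)} [IsLocallyFiniteMeasure γ]
    (hsupp : ∀ U : Set (SeqL2 n), IsOpen U → (U ∩ fourierEllipsoid n m).Nonempty →
      0 < γ (U ∩ fourierEllipsoid n m))
    {A : Fin N → Multiset (Fin n → ℤ)} (F : StrongDual ℂ (Fin N → ℂ)) {c : SeqL2 n}
    (hc : c ∈ fourierEllipsoid n m) (hF : 0 < (F (monomialVector A c)).re) :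
    ∃ r ρ, ∃ q ∈ analyticPolys n r ρ,
      0 < (F (densityMoment m γ A fun c => ‖q c‖ ^ 2)).re := by
  obtain ⟨ρ, hρ⟩ := exists_harmonicBox A
  obtain ⟨v, hv, hFv⟩ := exists_boundary_point hρ F hc hF
  set S := harmonicBox n ρ
  have hE := isCompact_fourierEllipsoid n hm
  have hpc : Continuous (peakFunction m S v) := by
    refine continuous_const.mul (continuous_const.add (continuous_finsetSum _ fun a _ => ?_))
    exact (continuous_coord a).const_mul _
  have hH : Continuous fun c => (F (monomialVector A c)).re :=
    Complex.continuous_re.comp (F.continuous.comp (continuous_monomialVector A))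
  have hnn : ∀ c : SeqL2 n, 0 ≤ ∑ a ∈ S, weight m a * ‖c a - v a‖ ^ 2 := fun c =>
    Finset.sum_nonneg fun a _ => mul_nonneg (weight_pos m a).le (sq_nonneg _)
  obtain ⟨k, hk⟩ := exists_setIntegral_mul_pow_pos hE hsupp hH
    (φ := fun c => ‖peakFunction m S v c‖ ^ 2) (hpc.norm.pow 2) (fun c => sq_nonneg _)
    (fun c hc => (norm_peakFunction_sq_le hv hc).trans (by linarith [hnn c]))
    (finiteSeq_mem_fourierEllipsoid hv.le) (by rw [peakFunction_finiteSeq hv]; simp) hFv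
    (fun c hc h1 => by
      have h2 := norm_peakFunction_sq_le hv hc
      have h3 : ∑ a ∈ S, weight m a * ‖c a - v a‖ ^ 2 = 0 :=
        le_antisymm (by linarith) (hnn c)
      rw [Finset.sum_eq_zero_iff_of_nonneg
        fun a _ => mul_nonneg (weight_pos m a).le (sq_nonneg _)] at h3
      refine congrArg (fun y => (F y).re) (monomialVector_congr hρ fun a ha => ?_)
      have h4 := h3 a ha
      rw [mul_eq_zero, or_iff_right (weight_pos m a).ne', sq_eq_zero_iff, norm_eq_zero,
        sub_eq_zero] at h4
      rw [h4, finiteSeq_apply, if_pos ha])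
  obtain ⟨r, hr⟩ := peakFunction_pow_mem_analyticPolys m ρ k v
  refine ⟨r, ρ, _, hr, ?_⟩
  have hint : IntegrableOn (fun c => ‖peakFunction m S v c ^ k‖ ^ 2 • monomialVector A c)
      (fourierEllipsoid n m) γ :=
    integrableOn_smul_monomialVector hm γ A ((hpc.pow k).norm.pow 2)
  convert! hk using 1
  let G : (Fin N → ℂ) →L[ℝ] ℝ := Complex.reCLM.comp (F.restrictScalars ℝ)
  refine (G.integral_comp_comm hint).symm.trans ?_
  refine integral_congr_ae (Filter.Eventually.of_forall fun c => ?_)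
  simp only [map_smul, smul_eq_mul, norm_pow]
  rw [mul_comm, ← pow_mul, ← pow_mul, mul_comm k 2]
  rfl

end Peak

/-! ### Density of the inner cone -/

section Density

open scoped NNReal

variable {n m N : ℕ}

theorem continuous_of_mem_analyticPolys {r ρ : ℕ} {g : SeqL2 n → ℂ}
    (hg : g ∈ analyticPolys n r ρ) : Continuous g :=
  continuous_of_mem_conjPolys (analyticPolys_subset_conjPolys n r ρ hg)

theorem sumsOfSquares_add {V : Set (SeqL2 n → ℂ)} {s t : SeqL2 n → ℝ} (hs : s ∈ sumsOfSquares V)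
    (ht : t ∈ sumsOfSquares V) : (fun c => s c + t c) ∈ sumsOfSquares V := by
  obtain ⟨l, q, hq, hs⟩ := hs
  obtain ⟨l', q', hq', ht⟩ := ht
  refine ⟨l + l', Fin.append q q', fun k => ?_, fun c => ?_⟩
  · induction k using Fin.addCases with
    | left i => simpa using hq i
    | right i => simpa using hq' i
  · simp [Fin.sum_univ_add, hs, ht]

theorem sumsOfSquares_smul {r ρ : ℕ} {s : SeqL2 n → ℝ}
    (hs : s ∈ sumsOfSquares (analyticPolys n r ρ)) (t : ℝ≥0) :
    (fun c => (t : ℝ) * s c) ∈ sumsOfSquares (analyticPolys n r ρ) := by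
  obtain ⟨l, q, hq, hs⟩ := hs
  refine ⟨l, fun k c => (√(t : ℝ) : ℂ) * q k c, fun k => ?_, fun c => ?_⟩
  · obtain ⟨P, hr, hρ, hP⟩ := hq k
    refine ⟨MvPolynomial.C (√(t : ℝ) : ℂ) * P, ?_, fun a ha => hρ a ?_, fun c => ?_⟩
    · rw [← MvPolynomial.smul_eq_C_mul]
      exact (MvPolynomial.totalDegree_smul_le _ _).trans hr
    · classical
      simpa using MvPolynomial.vars_mul _ _ ha
    · simp only [hP, map_mul, MvPolynomial.eval_C]
  · simp only [hs]
    rw [Finset.mul_sum]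
    refine Finset.sum_congr rfl fun k _ => ?_
    rw [norm_mul, mul_pow, Complex.norm_real, Real.norm_of_nonneg (Real.sqrt_nonneg _),
      Real.sq_sqrt t.coe_nonneg]

/-- The convex cone generated by the moment vectors of the densities `|q|²`, `q` analytic. -/
def squareCone (m : ℕ) (γ : Measure (SeqL2 n)) (A : Fin N → Multiset (Fin n → ℤ)) :
    Submodule ℝ≥0 (Fin N → ℂ) :=
  Submodule.span ℝ≥0 ((fun q : SeqL2 n → ℂ => densityMoment m γ A fun c => ‖q c‖ ^ 2) ''
    ⋃ (r : ℕ) (ρ : ℕ), analyticPolys n r ρ)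

theorem exists_sumsOfSquares_of_mem_squareCone (hm : 0 < m) (γ : Measure (SeqL2 n))
    [IsLocallyFiniteMeasure γ] (A : Fin N → Multiset (Fin n → ℤ)) {y : Fin N → ℂ}
    (hy : y ∈ squareCone m γ A) :
    ∃ r ρ, ∃ s ∈ sumsOfSquares (analyticPolys n r ρ), y = densityMoment m γ A s := by
  have hcont : ∀ {r ρ : ℕ} {s : SeqL2 n → ℝ}, s ∈ sumsOfSquares (analyticPolys n r ρ) →
      Continuous s := fun hs =>
    continuous_of_mem_sumsOfSquares (fun _ => continuous_of_mem_analyticPolys) hs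
  induction hy using Submodule.span_induction with
  | mem x hx =>
    obtain ⟨q, hq, rfl⟩ := hx
    obtain ⟨r, ρ, hq⟩ := Set.mem_iUnion₂.1 hq
    exact ⟨r, ρ, _, ⟨1, fun _ => q, fun _ => hq, fun c => by simp⟩, rfl⟩
  | zero => exact ⟨0, 0, 0, ⟨0, Fin.elim0, fun k => k.elim0, by simp⟩, by simp [densityMoment]⟩
  | add x y _ _ hx hy =>
    obtain ⟨r, ρ, s, hs, rfl⟩ := hx
    obtain ⟨r', ρ', t, ht, rfl⟩ := hy
    refine ⟨max r r', max ρ ρ', _, sumsOfSquares_add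
      (sumsOfSquares_mono (analyticPolys_mono (le_max_left _ _) (le_max_left _ _)) hs)
      (sumsOfSquares_mono (analyticPolys_mono (le_max_right _ _) (le_max_right _ _)) ht), ?_⟩
    simp only [densityMoment, add_smul]
    exact (integral_add (integrableOn_smul_monomialVector hm γ A (hcont hs))
      (integrableOn_smul_monomialVector hm γ A (hcont ht))).symm
  | smul a x _ hx =>
    obtain ⟨r, ρ, s, hs, rfl⟩ := hx
    refine ⟨r, ρ, _, sumsOfSquares_smul hs a, ?_⟩
    simp only [densityMoment, mul_smul, integral_smul]
    rfl

theorem squareCone_subset_innerCone (hm : 0 < m) (γ : Measure (SeqL2 n))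
    [IsLocallyFiniteMeasure γ] (A : Fin N → Multiset (Fin n → ℤ)) :
    (squareCone m γ A : Set (Fin N → ℂ)) ⊆
      innerCone m γ (fullQuadraticModule m (analyticPolys n)) A := by
  intro y hy
  obtain ⟨r, ρ, s, hs, rfl⟩ := exists_sumsOfSquares_of_mem_squareCone hm γ A hy
  have hs' := sumsOfSquares_mono (analyticPolys_mono (Nat.le_succ r) (le_refl ρ)) hs
  -- At level `r + 1` the multiplier `s₁ = 0` is simply an empty sum of squares.
  refine ⟨s, Set.mem_iUnion₂.2 ⟨r + 1, ρ, s, hs', 0,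
    ⟨0, Fin.elim0, fun k => k.elim0, by simp⟩, by simp⟩, fun k => ?_⟩
  exact densityMoment_apply hm γ A
    (continuous_of_mem_sumsOfSquares (fun _ => continuous_of_mem_analyticPolys) hs) k

theorem re_apply_nnreal_smul (F : StrongDual ℂ (Fin N → ℂ)) (t : ℝ≥0) (y : Fin N → ℂ) :
    (F (t • y)).re = t * (F y).re := by
  have h : t • y = ((t : ℝ) : ℂ) • y := rfl
  rw [h, map_smul, smul_eq_mul, Complex.re_ofReal_mul]

theorem re_nonpos_of_re_lt_on_cone {D : Submodule ℝ≥0 (Fin N → ℂ)} {F : StrongDual ℂ (Fin N → ℂ)}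
    {u : ℝ} (h : ∀ y ∈ D, (F y).re < u) {y : Fin N → ℂ} (hy : y ∈ D) : (F y).re ≤ 0 := by
  by_contra! hpos
  have hu : 0 < u := by simpa using h 0 (zero_mem D)
  -- This scaling makes the functional take exactly the forbidden value `u`.
  obtain ⟨a, ha⟩ : ∃ a : ℝ≥0, (a : ℝ) = u / (F y).re := ⟨⟨u / (F y).re, by positivity⟩, rfl⟩
  have h1 := h _ (Submodule.smul_mem D a hy)
  rw [re_apply_nnreal_smul, ha, div_mul_cancel₀ _ hpos.ne'] at h1
  exact lt_irrefl _ h1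

/-- A functional separating a point from the closed square cone is nonpositive on that cone, hence
by the peaking argument at every monomial vector, hence on all of `pointCone`, to which the point
belongs. -/
theorem pointCone_subset_closure_squareCone (hm : 0 < m) {γ : Measure (SeqL2 n)}
    [IsLocallyFiniteMeasure γ]
    (hsupp : ∀ U : Set (SeqL2 n), IsOpen U → (U ∩ fourierEllipsoid n m).Nonempty →
      0 < γ (U ∩ fourierEllipsoid n m)) (A : Fin N → Multiset (Fin n → ℤ)) :
    (pointCone m A : Set (Fin N → ℂ)) ⊆ closure (squareCone m γ A) := by
  intro y hy
  by_contra hcon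
  have hconv : Convex ℝ (squareCone m γ A : Set (Fin N → ℂ)) := fun x hx y hy a b ha hb _ =>
    add_mem (Submodule.smul_mem _ (⟨a, ha⟩ : ℝ≥0) hx) (Submodule.smul_mem _ (⟨b, hb⟩ : ℝ≥0) hy)
  obtain ⟨F, u, hFu, huy⟩ :=
    RCLike.geometric_hahn_banach_closed_point (𝕜 := ℂ) hconv.closure isClosed_closure hcon
  have hsq : ∀ x ∈ squareCone m γ A, (F x).re < u := fun x hx => hFu x (subset_closure hx)
  have hu : 0 < u := by simpa using hsq 0 (zero_mem _)
  have hpt : ∀ c ∈ fourierEllipsoid n m, (F (monomialVector A c)).re ≤ 0 := by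
    intro c hc
    by_contra! hpos
    obtain ⟨r, ρ, q, hq, hpos'⟩ := exists_densityMoment_pos hm hsupp F hc hpos
    exact absurd (re_nonpos_of_re_lt_on_cone hsq
      (Submodule.subset_span ⟨q, Set.mem_iUnion₂.2 ⟨r, ρ, hq⟩, rfl⟩)) (not_le.2 hpos')
  have hcone : ∀ x ∈ pointCone m A, (F x).re ≤ 0 := by
    intro x hx
    induction hx using Submodule.span_induction with
    | mem x hx =>
      obtain ⟨c, hc, rfl⟩ := hx
      exact hpt c hc
    | zero => simp
    | add x y _ _ hx hy =>
      rw [map_add, Complex.add_re]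
      exact add_nonpos hx hy
    | smul a x _ hx =>
      rw [re_apply_nnreal_smul]
      exact mul_nonpos_of_nonneg_of_nonpos a.2 hx
  exact absurd (hu.trans huy) (not_lt.2 (hcone y hy))

/-- Sandwich: continuity of the functions in `V` gives the upper bound, and containing the analytic
polynomials gives the lower one, so analytic and conjugate polynomials are treated alike. -/
theorem closure_innerCone_eq_momentCone (hm : 0 < m) {γ : Measure (SeqL2 n)}
    [IsLocallyFiniteMeasure γ]
    (hsupp : ∀ U : Set (SeqL2 n), IsOpen U → (U ∩ fourierEllipsoid n m).Nonempty →
      0 < γ (U ∩ fourierEllipsoid n m)) (A : Fin N → Multiset (Fin n → ℤ))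
    {V : ℕ → ℕ → Set (SeqL2 n → ℂ)} (hV : ∀ r ρ, analyticPolys n r ρ ⊆ V r ρ)
    (hVc : ∀ r ρ, ∀ g ∈ V r ρ, Continuous g) :
    closure (innerCone m γ (fullQuadraticModule m V) A) = momentCone m A := by
  rw [momentCone_eq_pointCone hm]
  refine Set.Subset.antisymm ?_ ?_
  · exact closure_minimal (innerCone_subset_pointCone hm γ A fun p hp =>
      continuous_and_nonneg_of_mem_fullQuadraticModule hVc hp) (isClosed_pointCone hm A)
  · refine (pointCone_subset_closure_squareCone hm hsupp A).trans
      (closure_mono ((squareCone_subset_innerCone hm γ A).trans ?_))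
    rintro y ⟨p, hp, hy⟩
    exact ⟨p, fullQuadraticModule_mono hV hp, hy⟩

end Density

end SobolevMoment

end

theorem mainTheorem4 (n m N : ℕ) (hn : 0 < n) (hm : 0 < m) (hN : 0 < N)
    (A : Fin N → Multiset (Fin n → ℤ))
    (γ : MeasureTheory.Measure (SobolevMoment.SeqL2 n))
    (hfin : MeasureTheory.IsLocallyFiniteMeasure γ)
    (hsupp : ∀ U : Set (SobolevMoment.SeqL2 n), IsOpen U →
      (U ∩ SobolevMoment.fourierEllipsoid n m).Nonempty →
      0 < γ (U ∩ SobolevMoment.fourierEllipsoid n m)) :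
    closure (SobolevMoment.innerCone m γ
        (SobolevMoment.fullQuadraticModule m (SobolevMoment.analyticPolys n)) A) =
      SobolevMoment.momentCone m A ∧
    closure (SobolevMoment.innerCone m γ
        (SobolevMoment.fullQuadraticModule m (SobolevMoment.conjPolys n)) A) =
      SobolevMoment.momentCone m A :=
  ⟨SobolevMoment.closure_innerCone_eq_momentCone hm hsupp A (fun _ _ => subset_rfl)
      fun _ _ _ => SobolevMoment.continuous_of_mem_analyticPolys,
    SobolevMoment.closure_innerCone_eq_momentCone hm hsupp A
      (SobolevMoment.analyticPolys_subset_conjPolys n)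
      fun _ _ _ => SobolevMoment.continuous_of_mem_conjPolys⟩
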